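/- Let $\Bbbk$ be a commutative ring. An object $X$ of a $\Bbbk$-linear category is called scalar if the map $\Bbbk\to\mathrm{End}(X)$, $\alpha\mapsto\alpha\,\mathrm{id}_X$, is bijective. A fusion category over $\Bbbk$ is a rigid monoidal $\Bbbk$-linear category with finite direct sums and $\Bbbk$-bilinear monoidal product such that every object is a finite direct sum of scalar objects, $\mathrm{Hom}(i,j)=0$ for any non-isomorphic scalar objects $i,j$, there are finitely many isomorphism classes of scalar objects, and the unit object $\mathbb 1$ is scalar. A pivotal category is a rigid monoidal category in which every object $X$ is given a dual object $X^*$ that is both a left dual, via $\mathrm{ev}_X\colon X^*\otimes X\to\mathbb 1$ and $\mathrm{coev}_X\colon\mathbb 1\to X\otimes X^*$, and a right dual, via $\widetilde{\mathrm{ev}}_X\colon X\otimes X^*\to\mathbb 1$ and $\widetilde{\mathrm{coev}}_X\colon\mathbb 1\to X^*\otimes X$, such that the resulting left and right dual functors coincide as monoidal functors. The left and right dimensions of $X$ are $\dim_l(X)=\mathrm{ev}_X\circ\widetilde{\mathrm{coev}}_X$ and $\dim_r(X)=\widetilde{\mathrm{ev}}_X\circ\mathrm{coev}_X$. The dimension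 of a pivotal fusion category $\mathcal C$ over $\Bbbk$ is $\dim(\mathcal C)=\sum_{i\in I}\dim_r(i)\dim_l(i)\in\mathrm{End}(\mathbb 1)=\Bbbk$, where $I$ is a set of representatives of the isomorphism classes of scalar objects of $\mathcal C$. Theorem. Let $\Bbbk$ be a field, $\mathcal C$ a pivotal fusion category over $\Bbbk$, and $\mathcal Z(\mathcal C)$ its center, that is, the braided $\Bbbk$-linear monoidal category of half braidings $(A,\sigma)$, where $A$ is an object of $\mathcal C$ and $\sigma=\{\sigma_X\colon A\otimes X\to X\otimes A\}_{X\in\mathcal C}$ is a natural isomorphism with $\sigma_{X\otimes Y}=(\mathrm{id}_X\otimes\sigma_Y)(\sigma_X\otimes\mathrm{id}_Y)$ (up to associativity constraints), and whose morphisms are the morphisms of $\mathcal C$ compatible with the half braidings. Then $\mathcal Z(\mathcal C)$ is an abelian category, and: (a) $\mathcal Z(\mathcal C)$ is semisimple (i.e. every object is a direct sum of simple objects) if and only if $\dim(\mathcal C)\neq 0$. (b) If $\Bbbk$ is algebraically closed, then $\mathcal Z(\mathcal C)$ is a fusion category over $\Bbbk$ if and only if $\dim(\mathcal C)\neq 0$.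 -/

import Mathlib

open CategoryTheory CategoryTheory.Limits CategoryTheory.MonoidalCategory

universe w v u

namespace FusionCenter


section Pivotal

/-- A pivotal structure on a monoidal category (and so, in particular, the rigidity of that
category). Every object `X` has a dual object `X* = dual X` with morphisms

* `X* ⊗ X ⟶ 𝟙`, `𝟙 ⟶ X ⊗ X*` making `X*` a left dual of `X` (this is `leftPairing X`);
* `X ⊗ X* ⟶ 𝟙`, `𝟙 ⟶ X* ⊗ X` making `X*` a right dual of `X` (this is `rightPairing X`);

and the left and right dual functors so defined are equal as monoidal functors: they agree on
morphisms, and their constraints `Y* ⊗ X* ≅ (X ⊗ Y)*` and `𝟙 ≅ 𝟙*` are equal.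

(Mathlib's `ExactPairing X Y` consists of `𝟙 ⟶ X ⊗ Y` and `Y ⊗ X ⟶ 𝟙` subject to the two
zigzag identities; Mathlib calls such a `Y` a right dual of `X`.) -/
class PivotalCategory (C : Type u) [Category.{v} C] [MonoidalCategory C] where
  dual : C → C
  leftPairing : ∀ X : C, ExactPairing X (dual X)
  rightPairing : ∀ X : C, ExactPairing (dual X) X
  mate_eq : ∀ {X Y : C} (f : X ⟶ Y),
    (@rightAdjointMate C _ _ X Y (@HasRightDual.mk C _ _ X (dual X) (leftPairing X))
      (@HasRightDual.mk C _ _ Y (dual Y) (leftPairing Y)) f : dual Y ⟶ dual X) =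
    @leftAdjointMate C _ _ X Y (@HasLeftDual.mk C _ _ X (dual X) (rightPairing X))
      (@HasLeftDual.mk C _ _ Y (dual Y) (rightPairing Y)) f
  tensor_eq : ∀ X Y : C,
    (rightDualIso
      (@ExactPairing.tensor C _ _ X Y (dual X) (dual Y) (leftPairing X) (leftPairing Y))
      (leftPairing (X ⊗ Y))).hom =
    (leftDualIso
      (@ExactPairing.tensor C _ _ (dual Y) (dual X) Y X (rightPairing Y) (rightPairing X))
      (rightPairing (X ⊗ Y))).hom
  unit_eq :
    (rightDualIso (exactPairingUnit : ExactPairing (𝟙_ C) (𝟙_ C)) (leftPairing (𝟙_ C))).hom =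
    (leftDualIso (exactPairingUnit : ExactPairing (𝟙_ C) (𝟙_ C)) (rightPairing (𝟙_ C))).hom

variable {C : Type u} [Category.{v} C] [MonoidalCategory C] [PivotalCategory C]

/-- The left evaluation `X* ⊗ X ⟶ 𝟙`. -/
def lev (X : C) : PivotalCategory.dual X ⊗ X ⟶ 𝟙_ C :=
  (PivotalCategory.leftPairing X).evaluation'

/-- The left coevaluation `𝟙 ⟶ X ⊗ X*`. -/
def lcoev (X : C) : 𝟙_ C ⟶ X ⊗ PivotalCategory.dual X :=
  (PivotalCategory.leftPairing X).coevaluation'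

/-- The right evaluation `X ⊗ X* ⟶ 𝟙`. -/
def rev (X : C) : X ⊗ PivotalCategory.dual X ⟶ 𝟙_ C :=
  (PivotalCategory.rightPairing X).evaluation'

/-- The right coevaluation `𝟙 ⟶ X* ⊗ X`. -/
def rcoev (X : C) : 𝟙_ C ⟶ PivotalCategory.dual X ⊗ X :=
  (PivotalCategory.rightPairing X).coevaluation'

/-- The left trace of an endomorphism. -/
def leftTrace {X : C} (f : X ⟶ X) : 𝟙_ C ⟶ 𝟙_ C :=
  rcoev X ≫ PivotalCategory.dual X ◁ f ≫ lev X

/-- The right trace of an endomorphism. -/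
def rightTrace {X : C} (f : X ⟶ X) : 𝟙_ C ⟶ 𝟙_ C :=
  lcoev X ≫ f ▷ PivotalCategory.dual X ≫ rev X

/-- The left dimension of an object. -/
def leftDim (X : C) : 𝟙_ C ⟶ 𝟙_ C := leftTrace (𝟙 X)

/-- The right dimension of an object. -/
def rightDim (X : C) : 𝟙_ C ⟶ 𝟙_ C := rightTrace (𝟙 X)

end Pivotal

section Fusion

variable (k : Type w) [CommRing k] {C : Type u} [Category.{v} C] [Preadditive C] [Linear k C]

/-- An object `X` is scalar if `k → End X`, `a ↦ a • 𝟙 X`, is bijective. -/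
def IsScalar (X : C) : Prop :=
  Function.Bijective fun a : k => (a • 𝟙 X : X ⟶ X)

/-- For a scalar object `X`, the endomorphism `f` of `X` seen as an element of `k`: the unique
`a` with `a • 𝟙 X = f`. -/
noncomputable def IsScalar.coeff {k : Type w} [CommRing k] {C : Type u} [Category.{v} C]
    [Preadditive C] [Linear k C] {X : C} (hX : IsScalar k X) (f : X ⟶ X) : k :=
  (Equiv.ofBijective _ hX).symm f

variable (C) in
/-- The set of isomorphism classes of scalar objects of `C`. -/
def scalarClasses : Set (Quotient (isIsomorphicSetoid C)) :=
  (Quotient.mk (isIsomorphicSetoid C)) '' {X : C | IsScalar k X}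

variable (C) in
/-- `C` is a fusion category over the commutative ring `k`. -/
class FusionCategory [MonoidalCategory C] : Prop where
  /-- The tensor product is biadditive. -/
  [monoidalPreadditive : MonoidalPreadditive C]
  /-- The tensor product is `k`-bilinear. -/
  [monoidalLinear : MonoidalLinear k C]
  [hasFiniteBiproducts : HasFiniteBiproducts C]
  /-- Every object has a left and a right dual. -/
  rigid : Nonempty (RigidCategory C)
  /-- Every object is a finite direct sum of scalar objects. -/
  exists_iso_biproduct : ∀ X : C, ∃ (n : ℕ) (S : Fin n → C),
    (∀ j, IsScalar k (S j)) ∧ Nonempty (X ≅ ⨁ S)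
  hom_eq_zero : ∀ i j : C, IsScalar k i → IsScalar k j → ¬ Nonempty (i ≅ j) →
    ∀ f : i ⟶ j, f = 0
  finite_scalarClasses : (scalarClasses k C).Finite
  unit_scalar : IsScalar k (𝟙_ C)

variable (C) in
/-- The dimension of a pivotal fusion category: the sum of `dim_r(i) dim_l(i)` over a set of
representatives `i` of the isomorphism classes of scalar objects, where `End(𝟙)` is identified
with `k`. -/
noncomputable def fusionDim [MonoidalCategory C] [PivotalCategory C] [FusionCategory k C] : k :=
  ∑ q ∈ (FusionCategory.finite_scalarClasses (k := k) (C := C)).toFinset,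
    (FusionCategory.unit_scalar (k := k) (C := C)).coeff (rightDim q.out) *
      (FusionCategory.unit_scalar (k := k) (C := C)).coeff (leftDim q.out)

end Fusion

section Abelian

variable (C : Type u) [Category.{v} C]

/-- A preadditive category is abelian (with its given addition of morphisms). -/
def IsAbelian [P : Preadditive C] : Prop :=
  ∃ A : Abelian C, A.toPreadditive = P

/-- Every object is a direct sum of simple objects. (Families indexed by `Type v` suffice: in
a direct sum `X` of simple objects the index set embeds into `X ⟶ X`, by sending an index to the
corresponding projector.) -/
def IsSemisimple [HasZeroMorphisms C] : Prop :=
  ∀ X : C, ∃ (ι : Type v) (S : ι → C) (c : Cofan S),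
    (∀ i, Simple (S i)) ∧ Nonempty (IsColimit c) ∧ Nonempty (X ≅ c.pt)

end Abelian

/-! The center of a `k`-linear monoidal category, with the addition and the scalar multiplication
of morphisms of the underlying category. -/

section Center

variable {C : Type u} [Category.{v} C] [MonoidalCategory C] [Preadditive C] [MonoidalPreadditive C]

instance (X Y : Center C) : Zero (X ⟶ Y) := ⟨⟨0, by simp⟩⟩

instance (X Y : Center C) : Add (X ⟶ Y) := ⟨fun f g => ⟨f.f + g.f, by simp⟩⟩

instance (X Y : Center C) : Neg (X ⟶ Y) :=
  ⟨fun f => ⟨-f.f, fun U => by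
    have h₁ : (-f.f) ▷ U = -(f.f ▷ U) := ((tensorRight U).map_neg (f := f.f) :)
    have h₂ : U ◁ (-f.f) = -(U ◁ f.f) := ((tensorLeft U).map_neg (f := f.f) :)
    simp [h₁, h₂]⟩⟩

@[simp] theorem center_zero_f (X Y : Center C) : (0 : X ⟶ Y).f = 0 := rfl

@[simp] theorem center_add_f {X Y : Center C} (f g : X ⟶ Y) : (f + g).f = f.f + g.f := rfl

@[simp] theorem center_neg_f {X Y : Center C} (f : X ⟶ Y) : (-f).f = -f.f := rfl

instance (X Y : Center C) : AddCommGroup (X ⟶ Y) where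
  add_assoc f g h := Center.ext _ _ (add_assoc f.f g.f h.f)
  zero_add f := Center.ext _ _ (zero_add f.f)
  add_zero f := Center.ext _ _ (add_zero f.f)
  neg_add_cancel f := Center.ext _ _ (neg_add_cancel f.f)
  add_comm f g := Center.ext _ _ (add_comm f.f g.f)
  nsmul := nsmulRec
  zsmul := zsmulRec

instance : Preadditive (Center C) where
  add_comp _ _ _ f f' g := Center.ext _ _ (Preadditive.add_comp _ _ _ f.f f'.f g.f)
  comp_add _ _ _ f g g' := Center.ext _ _ (Preadditive.comp_add _ _ _ f.f g.f g'.f)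

variable (k : Type w) [CommRing k] [Linear k C] [MonoidalLinear k C]

instance (X Y : Center C) : SMul k (X ⟶ Y) := ⟨fun a f => ⟨a • f.f, by simp⟩⟩

@[simp] theorem center_smul_f {X Y : Center C} (a : k) (f : X ⟶ Y) : (a • f).f = a • f.f := rfl

instance (X Y : Center C) : Module k (X ⟶ Y) where
  one_smul f := Center.ext _ _ (one_smul k f.f)
  mul_smul a b f := Center.ext _ _ (mul_smul a b f.f)
  smul_zero a := Center.ext _ _ (smul_zero a)
  smul_add a f g := Center.ext _ _ (smul_add a f.f g.f)
  add_smul a b f := Center.ext _ _ (add_smul a b f.f)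
  zero_smul f := Center.ext _ _ (zero_smul k f.f)

instance : Linear k (Center C) where
  smul_comp _ _ _ a f g := Center.ext _ _ (Linear.smul_comp _ _ _ a f.f g.f)
  comp_smul _ _ _ f a g := Center.ext _ _ (Linear.comp_smul _ _ _ f.f a g.f)

end Center

end FusionCenter

open scoped ZeroObject

/-! Composition is read in diagrammatic order. `C` is split semisimple over the field `k`: every
morphism `f` has a `g` with `f ≫ g ≫ f = f`, and idempotents split. For a morphism `f` of the
center, the idempotents `𝟙 - f ≫ g` and `𝟙 - g ≫ f` of `C` cut out a kernel and a cokernel. As `f`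
commutes with the half braidings, both inherit one. Monomorphisms and epimorphisms of the center
split in `C`, hence are normal, and the center is abelian (`center_isAbelian`).

If the dimension is nonzero, Maschke's argument applies. A morphism `g` of `C` between objects of
the center is averaged by conjugating it with the half braidings along a strand `s i`, closing that
strand by the right trace, and summing over `i` with weights `dim_l (s i)`. The result is a morphism
of the center (`exists_average`); this rests on `sum_partialTrace_tensor`, the invariance of the
weighted sum of strands under tensoring with an object. For `f` in the center with `f ≫ g ≫ f = f`,
the average `g'` satisfies `f ≫ g' ≫ f = dim(C) • f`, so every morphism of the center is regular in
the center (`exists_center_regular`). With finite-dimensional morphism spaces this gives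
semisimplicity.

Conversely, the forgetful functor has a right adjoint, with value `⨁ (s i ⊗ X) ⊗ (s i)*` at `X`
(`exists_isCofree`). Let `R` be its value at the unit and `η : 𝟙 ⟶ R` the unit of the adjunction.
The unit object is simple in the center and `η ≠ 0`, so semisimplicity provides a retraction `r` of
`η` in the center. Morphisms `𝟙 ⟶ R` in `C` are natural endomorphisms of the identity functor, and
`η` is the sum of the morphisms `a i` given by the isotypic projections. Encircling the projection
onto the unit component by a strand `s i` gives `a i ≫ r = c dim_r (s i) dim_l (s i) • 𝟙` with `c`
independent of `i` (`leftDim_smul_loop`, `exists_loop_lift`). Summing, `1 = c dim(C)`.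

Over an algebraically closed field, simple objects of the center are scalar by Schur's lemma. They
fall into finitely many classes because each one embeds in the cofree object on some `s i`. Duals
inherit half braidings, so the center is rigid. -/

namespace FusionCenter

/-! ### Linear algebra in a split semisimple category -/

section SimpleSystem

variable (k : Type w) [Field k] {C : Type u} [Category.{v} C] [Preadditive C] [Linear k C]

/-- A finite family of pairwise orthogonal scalar objects through which every identity morphism
factors additively. -/
structure IsSimpleSystem {I : Type*} [Fintype I] (s : I → C) : Prop where
  scalar : ∀ i, IsScalar k (s i)
  hom_eq_zero : ∀ i j, i ≠ j → ∀ f : s i ⟶ s j, f = 0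
  complete : ∀ X : C, ∃ (n : I → ℕ) (π : ∀ i, Fin (n i) → (X ⟶ s i))
    (ι : ∀ i, Fin (n i) → (s i ⟶ X)), ∑ i, ∑ a, π i a ≫ ι i a = 𝟙 X

variable {k}

theorem IsScalar.exists_smul {X : C} (hX : IsScalar k X) (f : X ⟶ X) : ∃ c : k, f = c • 𝟙 X :=
  (hX.2 f).imp fun _ h => h.symm

theorem IsScalar.id_ne_zero {X : C} (hX : IsScalar k X) : 𝟙 X ≠ 0 := fun h =>
  zero_ne_one (hX.1 (by simp [h] : (0 : k) • 𝟙 X = (1 : k) • 𝟙 X))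

theorem IsScalar.smul_id_injective {X : C} (hX : IsScalar k X) {a b : k}
    (h : a • 𝟙 X = b • 𝟙 X) : a = b := hX.1 h

theorem IsScalar.coeff_smul_id {X : C} (hX : IsScalar k X) (f : X ⟶ X) :
    hX.coeff f • 𝟙 X = f :=
  (Equiv.ofBijective _ hX).apply_symm_apply f

theorem IsScalar.of_iso {X Y : C} (hX : IsScalar k X) (e : X ≅ Y) : IsScalar k Y := by
  constructor
  · intro a b h
    apply hX.1
    have := congrArg (fun f => e.hom ≫ f ≫ e.inv) h
    simpa using this
  · intro f
    obtain ⟨c, hc⟩ := hX.exists_smul (e.hom ≫ f ≫ e.inv)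
    refine ⟨c, ?_⟩
    have := congrArg (fun f => e.inv ≫ f ≫ e.hom) hc
    simpa using this.symm

theorem exists_linearMap_regular {V W : Type*} [AddCommGroup V] [Module k V] [AddCommGroup W]
    [Module k W] (f : V →ₗ[k] W) : ∃ g : W →ₗ[k] V, ∀ x, f (g (f x)) = f x := by
  obtain ⟨t, ht⟩ := f.rangeRestrict.exists_rightInverse_of_surjective f.range_rangeRestrict
  obtain ⟨g, hg⟩ := LinearMap.exists_extend t
  refine ⟨g, fun x => ?_⟩
  have h1 : g (f x) = t ⟨f x, LinearMap.mem_range_self f x⟩ :=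
    LinearMap.congr_fun hg ⟨f x, LinearMap.mem_range_self f x⟩
  have h2 := congrArg Subtype.val (LinearMap.congr_fun ht ⟨f x, LinearMap.mem_range_self f x⟩)
  rw [h1]
  exact h2

namespace IsSimpleSystem

variable {I : Type*} [Fintype I] {s : I → C} (hs : IsSimpleSystem k s)
include hs

theorem hom_ext {X Y : C} {f g : X ⟶ Y} (h : ∀ i (x : s i ⟶ X), x ≫ f = x ≫ g) : f = g := by
  obtain ⟨n, π, ι, hX⟩ := hs.complete X
  rw [← Category.id_comp f, ← Category.id_comp g, ← hX]
  simp only [Preadditive.sum_comp, Category.assoc, h]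

theorem hom_ext' {X Y : C} {f g : X ⟶ Y} (h : ∀ i (y : Y ⟶ s i), f ≫ y = g ≫ y) : f = g := by
  obtain ⟨n, π, ι, hY⟩ := hs.complete Y
  rw [← Category.comp_id f, ← Category.comp_id g, ← hY]
  simp only [Preadditive.comp_sum, ← Category.assoc, h]

theorem exists_retraction {X : C} {i : I} (x : s i ⟶ X) (hx : x ≠ 0) :
    ∃ y : X ⟶ s i, x ≫ y = 𝟙 _ := by
  have : ∃ (j : I) (y : X ⟶ s j), x ≫ y ≠ 0 := by
    by_contra! h
    exact hx (hs.hom_ext' fun j y => by simp [h])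
  obtain ⟨j, y, hy⟩ := this
  obtain rfl | hij := eq_or_ne i j
  · obtain ⟨c, hc⟩ := (hs.scalar i).exists_smul (x ≫ y)
    have hc0 : c ≠ 0 := by rintro rfl; exact hy (by simpa using hc)
    exact ⟨c⁻¹ • y, by rw [Linear.comp_smul, hc, smul_smul, inv_mul_cancel₀ hc0, one_smul]⟩
  · exact absurd (hs.hom_eq_zero i j hij _) hy

theorem finite_hom (X Y : C) : Module.Finite k (X ⟶ Y) := by
  obtain ⟨n, π, ι, hX⟩ := hs.complete X
  obtain ⟨m, π', ι', hY⟩ := hs.complete Y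
  let S : Set (X ⟶ Y) := Set.range fun x : (Σ i, Fin (n i) × Fin (m i)) =>
    π x.1 x.2.1 ≫ ι' x.1 x.2.2
  have hS : S.Finite := Set.finite_range _
  refine ⟨⟨hS.toFinset, ?_⟩⟩
  rw [Set.Finite.coe_toFinset, Submodule.eq_top_iff']
  intro f
  have hf : f = (∑ i, ∑ a, π i a ≫ ι i a) ≫ f ≫ (∑ i, ∑ a, π' i a ≫ ι' i a) := by
    simp [hX, hY]
  rw [hf]
  simp only [Preadditive.sum_comp, Preadditive.comp_sum]
  refine Submodule.sum_mem _ fun i _ => Submodule.sum_mem _ fun a _ => Submodule.sum_mem _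
    fun j _ => Submodule.sum_mem _ fun b _ => ?_
  obtain rfl | hij := eq_or_ne j i
  · obtain ⟨c, hc⟩ := (hs.scalar j).exists_smul (ι j b ≫ f ≫ π' j a)
    have : (π j b ≫ ι j b) ≫ f ≫ π' j a ≫ ι' j a = c • (π j b ≫ ι' j a) := by
      have := congrArg (fun t => π j b ≫ t ≫ ι' j a) hc
      simpa using this
    rw [this]
    exact Submodule.smul_mem _ _ (Submodule.subset_span ⟨⟨j, b, a⟩, rfl⟩)
  · have : (π j b ≫ ι j b) ≫ f ≫ π' i a ≫ ι' i a = 0 := by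
      have := congrArg (fun t => π j b ≫ t ≫ ι' i a)
        (hs.hom_eq_zero j i hij (ι j b ≫ f ≫ π' i a))
      simpa using this
    rw [this]
    exact Submodule.zero_mem _

/-- Fullness of `X ↦ (Hom(s i, X))ᵢ`; with `hom_ext` it reduces questions about morphisms of `C` to
linear maps between vector spaces. -/
theorem exists_hom {X Y : C} (g : ∀ i, (s i ⟶ X) →ₗ[k] (s i ⟶ Y)) :
    ∃ f : X ⟶ Y, ∀ i (x : s i ⟶ X), x ≫ f = g i x := by
  obtain ⟨n, π, ι, hX⟩ := hs.complete X
  refine ⟨∑ i, ∑ a, π i a ≫ g i (ι i a), fun j x => ?_⟩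
  have key : ∀ i a, x ≫ π i a ≫ g i (ι i a) = g j (x ≫ π i a ≫ ι i a) := by
    intro i a
    obtain rfl | hij := eq_or_ne j i
    · obtain ⟨c, hc⟩ := (hs.scalar j).exists_smul (x ≫ π j a)
      rw [← Category.assoc, ← Category.assoc, hc]
      simp
    · rw [← Category.assoc, ← Category.assoc, hs.hom_eq_zero j i hij (x ≫ π i a)]
      simp
  simp only [Preadditive.comp_sum, key, ← map_sum]
  simp only [← Preadditive.comp_sum, hX, Category.comp_id]

/-- Linear maps over a field have generalized inverses, and these assemble into a morphism by
`exists_hom`. -/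
theorem exists_regular {X Y : C} (f : X ⟶ Y) : ∃ g : Y ⟶ X, f ≫ g ≫ f = f := by
  choose g hg using fun i => exists_linearMap_regular (Linear.rightComp k (s i) f)
  obtain ⟨g', hg'⟩ := hs.exists_hom g
  refine ⟨g', hs.hom_ext fun i x => ?_⟩
  have := hg i x
  simp only [Linear.rightComp_apply] at this
  rw [← Category.assoc, ← Category.assoc, hg', this]

/-- Induction on the rank of composition with `e` on `End X`. A nonzero `e` does not kill some map
from a simple object; this splits off a summand `t ≫ h` isomorphic to `s j`, and the rest `e - t ≫
h` is an idempotent of smaller rank. -/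
theorem exists_split_idempotent [HasFiniteBiproducts C] {X : C} (e : X ⟶ X) (he : e ≫ e = e) :
    ∃ (K : C) (i : K ⟶ X) (p : X ⟶ K), i ≫ p = 𝟙 K ∧ p ≫ i = e := by
  have := hs.finite_hom X X
  have := hasBinaryBiproducts_of_finite_biproducts C
  induction hn : Module.finrank k (LinearMap.range (Linear.rightComp k X e))
    using Nat.strong_induction_on generalizing e with
  | _ n ih =>
  by_cases h0 : e = 0
  · have := hasZeroObject_of_hasFiniteBiproducts C
    exact ⟨0, 0, 0, Subsingleton.elim _ _, by simp [h0]⟩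
  have : ∃ (j : I) (x : s j ⟶ X), x ≫ e ≠ 0 := by
    by_contra! h
    exact h0 (hs.hom_ext fun j y => by simp [h])
  obtain ⟨j, x, hx⟩ := this
  obtain ⟨y, hy⟩ := hs.exists_retraction _ hx
  set h := x ≫ e with hh
  set t := e ≫ y with ht
  have h1 : h ≫ e = h := by rw [hh, Category.assoc, he]
  have h2 : e ≫ t = t := by rw [ht, ← Category.assoc, he]
  have h3 : h ≫ t = 𝟙 _ := by rw [ht, ← Category.assoc, h1, hy]
  have h1' : ∀ {Z} (z : X ⟶ Z), h ≫ e ≫ z = h ≫ z := fun z => by rw [← Category.assoc, h1]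
  have h2' : ∀ {Z} (z : _ ⟶ Z), e ≫ t ≫ z = t ≫ z := fun z => by rw [← Category.assoc, h2]
  have h3' : ∀ {Z} (z : _ ⟶ Z), h ≫ t ≫ z = z := fun z => by
    rw [← Category.assoc, h3, Category.id_comp]
  clear_value h t
  have he' : (e - t ≫ h) ≫ (e - t ≫ h) = e - t ≫ h := by
    simp [he, h1, h2', h3']
  -- Were the ranges equal, `t ≫ h` would lie in the range of the idempotent `e - t ≫ h`, which
  -- annihilates it.
  have hlt : LinearMap.range (Linear.rightComp k X (e - t ≫ h)) <
      LinearMap.range (Linear.rightComp k X e) := by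
    refine lt_of_le_of_ne ?_ ?_
    · rintro _ ⟨a, rfl⟩
      exact ⟨a ≫ (e - t ≫ h), by simp [he, h1]⟩
    · intro heq
      have hm : t ≫ h ∈ LinearMap.range (Linear.rightComp k X e) := ⟨t ≫ h, by simp [h1]⟩
      rw [← heq] at hm
      obtain ⟨a, ha⟩ := hm
      have ha' : a ≫ (e - t ≫ h) = t ≫ h := ha
      have h4 : t ≫ h = 0 := by
        have := congrArg (fun z => z ≫ (e - t ≫ h)) ha'
        simp only [Category.assoc, he'] at this
        rw [ha'] at this
        rw [this]
        simp [h1, h3']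
      have h5 : 𝟙 (s j) = 0 := by
        have := congrArg (fun z => h ≫ z ≫ t) h4
        simpa [h3, h3'] using this
      exact (hs.scalar j).id_ne_zero h5
  obtain ⟨K, i, p, hip, hpi⟩ := ih _ (hn ▸ Submodule.finrank_lt_finrank_of_lt hlt) _ he' rfl
  have h6 : i ≫ t = 0 := by
    have : i ≫ t = i ≫ (p ≫ i) ≫ t := by simp [reassoc_of% hip]
    rw [this, hpi]
    simp [h2, h3]
  have h7 : h ≫ p = 0 := by
    have : h ≫ p = h ≫ (p ≫ i) ≫ p := by simp [hip]
    rw [this, hpi]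
    simp [h1', h3']
  refine ⟨s j ⊞ K, biprod.desc h i, biprod.lift t p, ?_, ?_⟩
  · ext <;> simp [h3, h6, h7, hip]
  · simp [biprod.lift_desc, hpi]

/-- The only morphisms between the `s i` are scalars, so naturality imposes no condition on the
components at the `s i`. This is the source of all natural families used below. -/
theorem exists_natTrans {D : Type*} [Category* D] [Preadditive D] [Linear k D] (F G : C ⥤ D)
    [F.Additive] [F.Linear k] [G.Additive] [G.Linear k]
    (φ : ∀ i, F.obj (s i) ⟶ G.obj (s i)) : ∃ α : F ⟶ G, ∀ i, α.app (s i) = φ i := by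
  choose n π ι hX using hs.complete
  have key : ∀ {i j} (g : s i ⟶ s j), F.map g ≫ φ j = φ i ≫ G.map g := by
    intro i j g
    obtain rfl | hij := eq_or_ne i j
    · obtain ⟨c, rfl⟩ := (hs.scalar i).exists_smul g
      simp [Functor.map_smul]
    · rw [hs.hom_eq_zero i j hij g]; simp
  let α : ∀ X, F.obj X ⟶ G.obj X := fun X => ∑ i, ∑ a, F.map (π X i a) ≫ φ i ≫ G.map (ι X i a)
  have hα : ∀ {i Y} (x : s i ⟶ Y), F.map x ≫ α Y = φ i ≫ G.map x := by
    intro i Y x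
    calc
      _ = ∑ j, ∑ b, F.map (x ≫ π Y j b) ≫ φ j ≫ G.map (ι Y j b) := by
        simp only [α, Preadditive.comp_sum, Functor.map_comp, Category.assoc]
      _ = ∑ j, ∑ b, φ i ≫ G.map (x ≫ π Y j b ≫ ι Y j b) := by
        refine Finset.sum_congr rfl fun j _ => Finset.sum_congr rfl fun b _ => ?_
        rw [← Category.assoc, key, Category.assoc, ← Functor.map_comp, Category.assoc]
      _ = _ := by
        simp only [← Preadditive.comp_sum, ← Functor.map_sum, hX, Category.comp_id]
  refine ⟨⟨α, fun X Y f => ?_⟩, fun i => ?_⟩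
  · calc
      _ = F.map ((∑ i, ∑ a, π X i a ≫ ι X i a) ≫ f) ≫ α Y := by rw [hX, Category.id_comp]
      _ = ∑ i, ∑ a, F.map (π X i a) ≫ F.map (ι X i a ≫ f) ≫ α Y := by
        simp only [Preadditive.sum_comp, Functor.map_sum, Functor.map_comp, Category.assoc]
      _ = _ := by
        simp only [hα]
        simp only [α, Preadditive.sum_comp, Functor.map_comp, Category.assoc]
  · simpa using hα (𝟙 (s i))

theorem natTrans_ext {D : Type*} [Category* D] [Preadditive D] {F G : C ⥤ D}
    [F.Additive] {α β : F ⟶ G} (h : ∀ i, α.app (s i) = β.app (s i)) : α = β := by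
  ext X
  obtain ⟨n, π, ι, hX⟩ := hs.complete X
  rw [← Category.id_comp (α.app X), ← Category.id_comp (β.app X), ← F.map_id, ← hX]
  simp [Functor.map_sum, Preadditive.sum_comp, h]

end IsSimpleSystem

theorem isSimpleSystem_of_decomposition {I : Type*} [Fintype I] {s : I → C}
    (h1 : ∀ i, IsScalar k (s i)) (h2 : ∀ i j, i ≠ j → ∀ f : s i ⟶ s j, f = 0)
    (h3 : ∀ X : C, ∃ (n : ℕ) (c : Fin n → I) (π : ∀ a, X ⟶ s (c a)) (ι : ∀ a, s (c a) ⟶ X),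
      ∑ a, π a ≫ ι a = 𝟙 X) : IsSimpleSystem k s := by
  classical
  refine ⟨h1, h2, fun X => ?_⟩
  obtain ⟨n, c, π, ι, h⟩ := h3 X
  -- All `n` indices serve for every `i`, padded by zero maps where `c a ≠ i`; the multiplicities
  -- need not be exact.
  refine ⟨fun _ => n, fun i a => if h : c a = i then π a ≫ eqToHom (by rw [h]) else 0,
    fun i a => if h : c a = i then eqToHom (by rw [h]) ≫ ι a else 0, ?_⟩
  rw [Finset.sum_comm, ← h]
  refine Finset.sum_congr rfl fun a _ => ?_
  rw [Finset.sum_eq_single (c a)]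
  · simp
  · intro i _ hi
    simp [hi.symm]
  · simp

end SimpleSystem

/-! ### Representatives of scalar objects form a simple system -/

section Fusion

variable {k : Type w} [Field k] {C : Type u} [Category.{v} C] [MonoidalCategory C]
  [Preadditive C] [Linear k C]

variable (k C) in
/-- The isomorphism classes of scalar objects of a fusion category. -/
abbrev ScalarClass [FusionCategory k C] : Type u :=
  (FusionCategory.finite_scalarClasses (k := k) (C := C)).toFinset

variable (k) in
/-- A representative of an isomorphism class of scalar objects. -/
noncomputable def scalarRep [FusionCategory k C] (q : ScalarClass k C) : C := q.1.out

variable [FusionCategory k C]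

theorem scalarRep_isScalar (q : ScalarClass k C) : IsScalar k (scalarRep k q) := by
  obtain ⟨X, hX, hq⟩ := (Set.Finite.mem_toFinset _).1 q.2
  have : Nonempty (X ≅ q.1.out) := by
    have h := Quotient.exact (hq.trans (Quotient.out_eq q.1).symm)
    exact h
  exact IsScalar.of_iso hX this.some

theorem exists_iso_scalarRep {X : C} (hX : IsScalar k X) :
    ∃ q : ScalarClass k C, Nonempty (X ≅ scalarRep k q) := by
  refine ⟨⟨Quotient.mk (isIsomorphicSetoid C) X, (Set.Finite.mem_toFinset _).2 ⟨X, hX, rfl⟩⟩, ?_⟩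
  have h := Quotient.exact (Quotient.out_eq (Quotient.mk (isIsomorphicSetoid C) X)).symm
  exact h

variable (k C) in
theorem isSimpleSystem_scalarRep :
    IsSimpleSystem k (scalarRep k : ScalarClass k C → C) := by
  have := FusionCategory.hasFiniteBiproducts (k := k) (C := C)
  refine isSimpleSystem_of_decomposition scalarRep_isScalar ?_ fun X => ?_
  · intro q r hqr f
    refine FusionCategory.hom_eq_zero (k := k) _ _ (scalarRep_isScalar q) (scalarRep_isScalar r)
      (fun h => hqr (Subtype.ext ?_)) f
    rw [← Quotient.out_eq q.1, ← Quotient.out_eq r.1]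
    exact Quotient.sound h
  · obtain ⟨n, S, hS, ⟨e⟩⟩ := FusionCategory.exists_iso_biproduct (k := k) X
    choose q hq using fun a => exists_iso_scalarRep (hS a)
    refine ⟨n, q, fun a => e.hom ≫ biproduct.π S a ≫ (hq a).some.hom,
      fun a => (hq a).some.inv ≫ biproduct.ι S a ≫ e.inv, ?_⟩
    have h := biproduct.total (f := S)
    calc
      _ = e.hom ≫ (∑ a, biproduct.π S a ≫ biproduct.ι S a) ≫ e.inv := by
        simp [Preadditive.sum_comp, Preadditive.comp_sum, -biproduct.total]
      _ = _ := by rw [h]; simp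

end Fusion
end FusionCenter

namespace FusionCenter

/-! ### Half braidings on split subobjects and quotients -/

section HalfBraiding

variable {C : Type u} [Category.{v} C] [MonoidalCategory C]

/-- A half braiding restricts along a split monomorphism `i` through which it factors. -/
def _root_.CategoryTheory.HalfBraiding.restrict {A K : C} (σ : HalfBraiding A) (i : K ⟶ A)
    (p : A ⟶ K) (hip : i ≫ p = 𝟙 K)
    (h : ∀ X, i ▷ X ≫ (σ.β X).hom ≫ X ◁ (p ≫ i) = i ▷ X ≫ (σ.β X).hom)
    (h' : ∀ X, X ◁ i ≫ (σ.β X).inv ≫ (p ≫ i) ▷ X = X ◁ i ≫ (σ.β X).inv) : HalfBraiding K where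
  β X :=
    { hom := i ▷ X ≫ (σ.β X).hom ≫ X ◁ p
      inv := X ◁ i ≫ (σ.β X).inv ≫ p ▷ X
      hom_inv_id := by
        have := h X
        simp only [MonoidalCategory.whiskerLeft_comp] at this
        simp only [Category.assoc, reassoc_of% this]
        simp [← comp_whiskerRight, hip]
      inv_hom_id := by
        have := h' X
        simp only [comp_whiskerRight] at this
        simp only [Category.assoc, reassoc_of% this]
        simp [← MonoidalCategory.whiskerLeft_comp, hip] }
  monoidal U V := by
    have hm : Mono ((U ⊗ V) ◁ i) := by
      have : (U ⊗ V) ◁ i ≫ (U ⊗ V) ◁ p = 𝟙 _ := by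
        rw [← MonoidalCategory.whiskerLeft_comp, hip, MonoidalCategory.whiskerLeft_id]
      exact mono_of_mono_fac this
    have hU := h U
    have hV := h V
    have hUV := h (U ⊗ V)
    simp only [MonoidalCategory.whiskerLeft_comp] at hU hV hUV
    rw [← cancel_mono ((U ⊗ V) ◁ i)]
    simp only [Category.assoc, hUV, comp_whiskerRight, MonoidalCategory.whiskerLeft_comp]
    rw [HalfBraiding.monoidal]
    have hV' := congrArg (fun t => U ◁ t) hV
    simp only [MonoidalCategory.whiskerLeft_comp] at hV'
    have hU' := congrArg (fun t => t ▷ V) hU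
    simp only [comp_whiskerRight] at hU'
    simp only [MonoidalCategory.tensor_whiskerLeft, Iso.inv_hom_id_assoc]
    rw [reassoc_of% hV']
    have e : ∀ {Z} (z : U ⊗ A ⊗ V ⟶ Z), (U ◁ p) ▷ V ≫ (α_ _ _ _).hom ≫ U ◁ i ▷ V ≫ z =
        (U ◁ p) ▷ V ≫ (U ◁ i) ▷ V ≫ (α_ _ _ _).hom ≫ z := by
      intro Z z
      simp
    rw [e, reassoc_of% hU']
    simp
  naturality {U V} f := by
    simp only [Category.assoc]
    rw [whisker_exchange_assoc, HalfBraiding.naturality_assoc, whisker_exchange]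

/-- A half braiding descends along a split epimorphism `p` through which it factors. -/
def _root_.CategoryTheory.HalfBraiding.corestrict {A K : C} (σ : HalfBraiding A) (i : K ⟶ A)
    (p : A ⟶ K) (hip : i ≫ p = 𝟙 K)
    (h : ∀ X, (p ≫ i) ▷ X ≫ (σ.β X).hom ≫ X ◁ p = (σ.β X).hom ≫ X ◁ p)
    (h' : ∀ X, X ◁ (p ≫ i) ≫ (σ.β X).inv ≫ p ▷ X = (σ.β X).inv ≫ p ▷ X) : HalfBraiding K where
  β X :=
    { hom := i ▷ X ≫ (σ.β X).hom ≫ X ◁ p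
      inv := X ◁ i ≫ (σ.β X).inv ≫ p ▷ X
      hom_inv_id := by
        have := h' X
        simp only [MonoidalCategory.whiskerLeft_comp, Category.assoc] at this
        simp only [Category.assoc, this]
        simp [← comp_whiskerRight, hip]
      inv_hom_id := by
        have := h X
        simp only [comp_whiskerRight, Category.assoc] at this
        simp only [Category.assoc, this]
        simp [← MonoidalCategory.whiskerLeft_comp, hip] }
  monoidal U V := by
    have hm : Epi (p ▷ (U ⊗ V)) := by
      have : i ▷ (U ⊗ V) ≫ p ▷ (U ⊗ V) = 𝟙 _ := by
        rw [← comp_whiskerRight, hip, id_whiskerRight]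
      exact epi_of_epi_fac this
    have hU := h U
    have hV := h V
    have hUV := h (U ⊗ V)
    simp only [comp_whiskerRight, Category.assoc] at hU hV hUV
    rw [← cancel_epi (p ▷ (U ⊗ V))]
    simp only [Category.assoc, hUV, comp_whiskerRight, MonoidalCategory.whiskerLeft_comp]
    rw [HalfBraiding.monoidal]
    have hV' := congrArg (fun t => U ◁ t) hV
    simp only [MonoidalCategory.whiskerLeft_comp] at hV'
    have hU' := congrArg (fun t => t ▷ V) hU
    simp only [comp_whiskerRight] at hU'
    simp only [MonoidalCategory.whiskerRight_tensor, Category.assoc, Iso.hom_inv_id_assoc]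
    rw [reassoc_of% hU']
    have e : ∀ {Z} (z : U ⊗ K ⊗ V ⟶ Z), (U ◁ p) ▷ V ≫ (α_ _ _ _).hom ≫ z =
        (α_ _ _ _).hom ≫ U ◁ p ▷ V ≫ z := by
      intro Z z
      simp
    rw [e, reassoc_of% hV']
    simp
  naturality {U V} f := by
    simp only [Category.assoc]
    rw [whisker_exchange_assoc, HalfBraiding.naturality_assoc, whisker_exchange]

/-- A factorization of a morphism of the center through a morphism that is a split monomorphism
in `C`. -/
def centerLift {K A D : Center C} (i : K ⟶ A) (p : A.1 ⟶ K.1) (hip : i.f ≫ p = 𝟙 _) (h : D ⟶ A)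
    (l : D.1 ⟶ K.1) (hl : l ≫ i.f = h.f) : D ⟶ K where
  f := l
  comm U := by
    have hm : Mono (U ◁ i.f) := by
      have : U ◁ i.f ≫ U ◁ p = 𝟙 _ := by
        rw [← MonoidalCategory.whiskerLeft_comp, hip, MonoidalCategory.whiskerLeft_id]
      exact mono_of_mono_fac this
    rw [← cancel_mono (U ◁ i.f), Category.assoc, Category.assoc, ← i.comm,
      ← MonoidalCategory.whiskerLeft_comp, hl, ← comp_whiskerRight_assoc, hl, h.comm]

/-- A factorization of a morphism of the center through a morphism that is a split epimorphism
in `C`. -/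
def centerDesc {K A D : Center C} (q : A ⟶ K) (r : K.1 ⟶ A.1) (hrq : r ≫ q.f = 𝟙 _) (h : A ⟶ D)
    (l : K.1 ⟶ D.1) (hl : q.f ≫ l = h.f) : K ⟶ D where
  f := l
  comm U := by
    have hm : Epi (q.f ▷ U) := by
      have : r ▷ U ≫ q.f ▷ U = 𝟙 _ := by
        rw [← comp_whiskerRight, hrq, id_whiskerRight]
      exact epi_of_epi_fac this
    rw [← cancel_epi (q.f ▷ U), ← comp_whiskerRight_assoc, hl, q.comm_assoc,
      ← MonoidalCategory.whiskerLeft_comp, hl, h.comm]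

end HalfBraiding

/-! ### The center is abelian -/

section Center

variable {C : Type u} [Category.{v} C] [MonoidalCategory C] [Preadditive C] [MonoidalPreadditive C]

instance : (Center.forget C).Additive where

theorem center_sum_f {X Y : Center C} {J : Type*} (S : Finset J) (g : J → (X ⟶ Y)) :
    (∑ j ∈ S, g j).f = ∑ j ∈ S, (g j).f :=
  (Center.forget C).map_sum (f := g) (s := S)

omit [MonoidalCategory C] [MonoidalPreadditive C] in
theorem _root_.CategoryTheory.MonoidalPreadditive.whiskerLeft_sub [MonoidalCategory C]
    [MonoidalPreadditive C] (X : C) {Y Z : C} (f g : Y ⟶ Z) :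
    X ◁ (f - g) = X ◁ f - X ◁ g :=
  (tensorLeft X).map_sub

omit [MonoidalCategory C] [MonoidalPreadditive C] in
theorem _root_.CategoryTheory.MonoidalPreadditive.sub_whiskerRight [MonoidalCategory C]
    [MonoidalPreadditive C] (X : C) {Y Z : C} (f g : Y ⟶ Z) :
    (f - g) ▷ X = f ▷ X - g ▷ X :=
  (tensorRight X).map_sub

section Biproduct

variable {J : Type} [Fintype J] {A : J → C} (b : Bicone A) (hb : ∑ j, b.π j ≫ b.ι j = 𝟙 b.pt)
include hb

theorem bicone_whiskerRight_hom_ext {X Z : C} {f g : b.pt ⊗ X ⟶ Z}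
    (h : ∀ j, b.ι j ▷ X ≫ f = b.ι j ▷ X ≫ g) : f = g := by
  rw [← Category.id_comp f, ← Category.id_comp g, ← id_whiskerRight, ← hb, sum_whiskerRight]
  simp only [Preadditive.sum_comp, comp_whiskerRight, Category.assoc, h]

theorem bicone_whiskerLeft_hom_ext {X Z : C} {f g : X ⊗ b.pt ⟶ Z}
    (h : ∀ j, X ◁ b.ι j ≫ f = X ◁ b.ι j ≫ g) : f = g := by
  rw [← Category.id_comp f, ← Category.id_comp g, ← MonoidalCategory.whiskerLeft_id, ← hb,
    whiskerLeft_sum]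
  simp only [Preadditive.sum_comp, MonoidalCategory.whiskerLeft_comp, Category.assoc, h]

omit [MonoidalCategory C] [MonoidalPreadditive C] hb in
theorem bicone_ι_comp_sum {D : Type*} [Category* D] [Preadditive D] (F : C ⥤ D) [F.Additive] {Z : D}
    (z : ∀ j, F.obj (A j) ⟶ Z) (j : J) :
    F.map (b.ι j) ≫ ∑ l, F.map (b.π l) ≫ z l = z j := by
  classical
  rw [Preadditive.comp_sum, Finset.sum_eq_single j]
  · rw [← Category.assoc, ← F.map_comp, bicone_ι_π_self b, F.map_id, Category.id_comp]
  · intro l _ hl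
    rw [← Category.assoc, ← F.map_comp, bicone_ι_π_ne b hl.symm, F.map_zero, zero_comp]
  · simp

/-- The half braiding of a finite direct sum. -/
noncomputable def biconeHalfBraiding (σ : ∀ j, HalfBraiding (A j)) : HalfBraiding b.pt :=
  have h1 : ∀ X j, b.ι j ▷ X ≫ (∑ l, b.π l ▷ X ≫ ((σ l).β X).hom ≫ X ◁ b.ι l) =
      ((σ j).β X).hom ≫ X ◁ b.ι j := fun X j =>
    bicone_ι_comp_sum b (tensorRight X) (fun l => ((σ l).β X).hom ≫ X ◁ b.ι l) j
  have h2 : ∀ X j, X ◁ b.ι j ≫ (∑ l, X ◁ b.π l ≫ ((σ l).β X).inv ≫ b.ι l ▷ X) =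
      ((σ j).β X).inv ≫ b.ι j ▷ X := fun X j =>
    bicone_ι_comp_sum b (tensorLeft X) (fun l => ((σ l).β X).inv ≫ b.ι l ▷ X) j
  { β := fun X =>
      { hom := ∑ j, b.π j ▷ X ≫ ((σ j).β X).hom ≫ X ◁ b.ι j
        inv := ∑ j, X ◁ b.π j ≫ ((σ j).β X).inv ≫ b.ι j ▷ X
        hom_inv_id := bicone_whiskerRight_hom_ext b hb fun j => by
          rw [reassoc_of% h1 X j, h2 X j]
          simp
        inv_hom_id := bicone_whiskerLeft_hom_ext b hb fun j => by
          rw [reassoc_of% h2 X j, h1 X j]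
          simp }
    monoidal := fun U V => bicone_whiskerRight_hom_ext b hb fun j => by
      have h1' := fun U V => congrArg (fun t => t ▷ V) (h1 U j)
      have h1'' := fun U V => congrArg (fun t => U ◁ t) (h1 V j)
      simp only [comp_whiskerRight, MonoidalCategory.whiskerLeft_comp] at h1' h1''
      rw [h1, MonoidalCategory.whiskerRight_tensor]
      simp only [Category.assoc, Iso.hom_inv_id_assoc]
      rw [reassoc_of% h1', associator_naturality_middle_assoc, reassoc_of% h1'']
      simp
    naturality := fun {U V} f => by
      simp only [Preadditive.comp_sum, Preadditive.sum_comp, Category.assoc]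
      refine Finset.sum_congr rfl fun j _ => ?_
      rw [whisker_exchange_assoc, HalfBraiding.naturality_assoc, whisker_exchange] }

theorem biconeHalfBraiding_ι (σ : ∀ j, HalfBraiding (A j)) (X : C) (j : J) :
    b.ι j ▷ X ≫ ((biconeHalfBraiding b hb σ).β X).hom = ((σ j).β X).hom ≫ X ◁ b.ι j :=
  bicone_ι_comp_sum b (tensorRight X) (fun l => ((σ l).β X).hom ≫ X ◁ b.ι l) j

theorem biconeHalfBraiding_π (σ : ∀ j, HalfBraiding (A j)) (X : C) (j : J) :
    b.π j ▷ X ≫ ((σ j).β X).hom = ((biconeHalfBraiding b hb σ).β X).hom ≫ X ◁ b.π j := by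
  classical
  refine bicone_whiskerRight_hom_ext b hb fun l => ?_
  rw [← comp_whiskerRight_assoc, ← Category.assoc, biconeHalfBraiding_ι, Category.assoc,
    ← MonoidalCategory.whiskerLeft_comp]
  obtain rfl | h := eq_or_ne l j
  · simp
  · simp [bicone_ι_π_ne b h]

end Biproduct

theorem center_hasFiniteBiproducts [HasFiniteBiproducts C] : HasFiniteBiproducts (Center C) := by
  refine ⟨fun n => ⟨fun A => ?_⟩⟩
  classical
  let b := biproduct.bicone fun j => (A j).1
  have hb : ∑ j, b.π j ≫ b.ι j = 𝟙 b.pt := biproduct.total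
  let B : Bicone A :=
    { pt := ⟨b.pt, biconeHalfBraiding b hb fun j => (A j).2⟩
      π := fun j => ⟨b.π j, fun U => biconeHalfBraiding_π b hb (fun j => (A j).2) U j⟩
      ι := fun j => ⟨b.ι j, fun U => biconeHalfBraiding_ι b hb (fun j => (A j).2) U j⟩
      ι_π := fun j l => Center.ext _ _ (by
        obtain rfl | h := eq_or_ne j l
        · rw [dif_pos rfl]
          exact bicone_ι_π_self b j
        · rw [dif_neg h]
          exact bicone_ι_π_ne b h) }
  refine hasBiproduct_of_total B (Center.ext _ _ ?_)
  rw [center_sum_f]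
  exact hb

variable (hreg : ∀ {X Y : C} (f : X ⟶ Y), ∃ g : Y ⟶ X, f ≫ g ≫ f = f)
  (hsplit : ∀ {X : C} (e : X ⟶ X), e ≫ e = e →
    ∃ (K : C) (i : K ⟶ X) (p : X ⟶ K), i ≫ p = 𝟙 K ∧ p ≫ i = e)
include hreg hsplit

/-- The kernel in `C` is the image of the idempotent `𝟙 - f ≫ g`. The half braiding of `A` preserves
it because `f` intertwines the half braidings and `i ≫ f = 0`. -/
theorem exists_center_kernel {A B : Center C} (f : A ⟶ B) :
    ∃ (K : Center C) (i : K ⟶ A) (p : A.1 ⟶ K.1) (g : B.1 ⟶ A.1),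
      i.f ≫ p = 𝟙 _ ∧ p ≫ i.f = 𝟙 _ - f.f ≫ g ∧ i.f ≫ f.f = 0 := by
  obtain ⟨g, hg⟩ := hreg f.f
  obtain ⟨K, i, p, hip, hpi⟩ := hsplit (𝟙 A.1 - f.f ≫ g) (by simp [reassoc_of% hg])
  have hif : i ≫ f.f = 0 := by
    have : i ≫ f.f = i ≫ (p ≫ i) ≫ f.f := by simp [reassoc_of% hip]
    rw [this, hpi]
    simp [hg]
  have h : ∀ X, i ▷ X ≫ (A.2.β X).hom ≫ X ◁ (p ≫ i) = i ▷ X ≫ (A.2.β X).hom := by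
    intro X
    have : i ▷ X ≫ (A.2.β X).hom ≫ X ◁ (f.f ≫ g) = 0 := by
      rw [MonoidalCategory.whiskerLeft_comp, ← f.comm_assoc, ← comp_whiskerRight_assoc, hif]
      simp
    rw [hpi, MonoidalPreadditive.whiskerLeft_sub, Preadditive.comp_sub, Preadditive.comp_sub, this]
    simp
  have h' : ∀ X, X ◁ i ≫ (A.2.β X).inv ≫ (p ≫ i) ▷ X = X ◁ i ≫ (A.2.β X).inv := by
    intro X
    have : X ◁ i ≫ (A.2.β X).inv ≫ (f.f ≫ g) ▷ X = 0 := by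
      have hc : (A.2.β X).inv ≫ f.f ▷ X = X ◁ f.f ≫ (B.2.β X).inv := by
        rw [Iso.inv_comp_eq, ← Category.assoc, Iso.eq_comp_inv, f.comm]
      rw [comp_whiskerRight, reassoc_of% hc, ← MonoidalCategory.whiskerLeft_comp_assoc, hif]
      simp
    rw [hpi, MonoidalPreadditive.sub_whiskerRight, Preadditive.comp_sub, Preadditive.comp_sub, this]
    simp
  refine ⟨⟨K, A.2.restrict i p hip h h'⟩, ⟨i, fun U => ?_⟩, p, g, hip, hpi, hif⟩
  have := h U
  rw [MonoidalCategory.whiskerLeft_comp] at this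
  simp [HalfBraiding.restrict, this]

theorem exists_center_cokernel {A B : Center C} (f : A ⟶ B) :
    ∃ (Q : Center C) (q : B ⟶ Q) (r : Q.1 ⟶ B.1) (g : B.1 ⟶ A.1),
      r ≫ q.f = 𝟙 _ ∧ q.f ≫ r = 𝟙 _ - g ≫ f.f ∧ f.f ≫ q.f = 0 := by
  obtain ⟨g, hg⟩ := hreg f.f
  obtain ⟨Q, r, q, hrq, hqr⟩ := hsplit (𝟙 B.1 - g ≫ f.f) (by simp [hg])
  have hfq : f.f ≫ q = 0 := by
    have : f.f ≫ q = f.f ≫ (q ≫ r) ≫ q := by simp [hrq]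
    rw [this, hqr]
    simp [reassoc_of% hg]
  have h : ∀ X, (q ≫ r) ▷ X ≫ (B.2.β X).hom ≫ X ◁ q = (B.2.β X).hom ≫ X ◁ q := by
    intro X
    have : (g ≫ f.f) ▷ X ≫ (B.2.β X).hom ≫ X ◁ q = 0 := by
      rw [comp_whiskerRight, Category.assoc, f.comm_assoc, ← MonoidalCategory.whiskerLeft_comp, hfq]
      simp
    rw [hqr, MonoidalPreadditive.sub_whiskerRight, Preadditive.sub_comp, this]
    simp
  have h' : ∀ X, X ◁ (q ≫ r) ≫ (B.2.β X).inv ≫ q ▷ X = (B.2.β X).inv ≫ q ▷ X := by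
    intro X
    have : X ◁ (g ≫ f.f) ≫ (B.2.β X).inv ≫ q ▷ X = 0 := by
      have hc : X ◁ f.f ≫ (B.2.β X).inv = (A.2.β X).inv ≫ f.f ▷ X := by
        rw [Iso.eq_inv_comp, ← Category.assoc, Iso.comp_inv_eq, f.comm]
      rw [MonoidalCategory.whiskerLeft_comp, Category.assoc, reassoc_of% hc, ← comp_whiskerRight,
        hfq]
      simp
    rw [hqr, MonoidalPreadditive.whiskerLeft_sub, Preadditive.sub_comp, this]
    simp
  refine ⟨⟨Q, B.2.corestrict r q hrq h h'⟩, ⟨q, fun U => ?_⟩, r, g, hrq, hqr, hfq⟩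
  have := h U
  rw [comp_whiskerRight, Category.assoc] at this
  simp [HalfBraiding.corestrict, this]

/-- The kernel built in `C` lives in the center, so it vanishes for a monomorphism of the center;
then `𝟙 - f ≫ g = 0`. -/
theorem exists_retraction_of_mono {A B : Center C} (f : A ⟶ B) [Mono f] :
    ∃ g : B.1 ⟶ A.1, f.f ≫ g = 𝟙 _ := by
  obtain ⟨K, i, p, g, hip, hpi, hif⟩ := exists_center_kernel hreg hsplit f
  have hi : i = 0 := (cancel_mono f).1 (Center.ext _ _ (by simp [hif]))
  refine ⟨g, ?_⟩
  simp only [hi, center_zero_f, comp_zero] at hpi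
  exact (sub_eq_zero.1 hpi.symm).symm

theorem exists_section_of_epi {A B : Center C} (f : A ⟶ B) [Epi f] :
    ∃ g : B.1 ⟶ A.1, g ≫ f.f = 𝟙 _ := by
  obtain ⟨Q, q, r, g, hrq, hqr, hfq⟩ := exists_center_cokernel hreg hsplit f
  have hq : q = 0 := (cancel_epi f).1 (Center.ext _ _ (by simp [hfq]))
  refine ⟨g, ?_⟩
  simp only [hq, center_zero_f, zero_comp] at hqr
  exact (sub_eq_zero.1 hqr.symm).symm

theorem center_isAbelian [HasFiniteBiproducts C] : IsAbelian (Center C) := by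
  have := center_hasFiniteBiproducts (C := C)
  have : HasFiniteProducts (Center C) := inferInstance
  have hk : HasKernels (Center C) := ⟨fun {A B} f => by
    obtain ⟨K, i, p, g, hip, hpi, hif⟩ := exists_center_kernel hreg hsplit f
    have hif' : i ≫ f = 0 := Center.ext _ _ hif
    refine HasLimit.mk ⟨_, KernelFork.IsLimit.ofι i hif' (fun {W} h hh => centerLift i p hip h
      (h.f ≫ p) ?_) (fun h hh => ?_) (fun h hh m hm => ?_)⟩
    · have : h.f ≫ f.f = 0 := congrArg Center.Hom.f hh
      simp [hpi, reassoc_of% this]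
    · have : h.f ≫ f.f = 0 := congrArg Center.Hom.f hh
      ext
      simp [centerLift, hpi, reassoc_of% this]
    · ext
      simp [centerLift, ← hm, hip]⟩
  have hc : HasCokernels (Center C) := ⟨fun {A B} f => by
    obtain ⟨Q, q, r, g, hrq, hqr, hfq⟩ := exists_center_cokernel hreg hsplit f
    have hfq' : f ≫ q = 0 := Center.ext _ _ hfq
    refine HasColimit.mk ⟨_, CokernelCofork.IsColimit.ofπ q hfq' (fun {W} h hh => centerDesc q r
      hrq h (r ≫ h.f) ?_) (fun h hh => ?_) (fun h hh m hm => ?_)⟩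
    · have : f.f ≫ h.f = 0 := congrArg Center.Hom.f hh
      simp [reassoc_of% hqr, this]
    · have : f.f ≫ h.f = 0 := congrArg Center.Hom.f hh
      ext
      simp [centerDesc, reassoc_of% hqr, this]
    · ext
      simp [centerDesc, ← hm, reassoc_of% hrq]⟩
  -- A monomorphism is the kernel of its cokernel: if `h ≫ q = 0`, then `h = h ≫ g' ≫ f` in `C`, so
  -- `h` factors through `f`; as `f` splits in `C`, the factor lies in the center.
  have hm : IsNormalMonoCategory (Center C) := ⟨fun {A B} f _ => by
    obtain ⟨g, hg⟩ := exists_retraction_of_mono hreg hsplit f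
    obtain ⟨Q, q, r, g', hrq, hqr, hfq⟩ := exists_center_cokernel hreg hsplit f
    have key : ∀ {W : Center C} (h : W ⟶ B), h ≫ q = 0 → (h.f ≫ g) ≫ f.f = h.f := by
      intro W h hh
      have h1 : h.f ≫ q.f = 0 := congrArg Center.Hom.f hh
      have h2 : h.f = h.f ≫ g' ≫ f.f := by
        have := congrArg (fun t => h.f ≫ t) hqr
        simp only [reassoc_of% h1, zero_comp, Preadditive.comp_sub, Category.comp_id] at this
        exact sub_eq_zero.1 this.symm
      rw [h2]
      simp [reassoc_of% hg]
    exact ⟨⟨Q, q, Center.ext _ _ hfq, KernelFork.IsLimit.ofι f _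
      (fun {W} h hh => centerLift f g hg h (h.f ≫ g) (key h hh))
      (fun h hh => Center.ext _ _ (key h hh))
      (fun h hh m hm => (cancel_mono f).1 (hm.trans (Center.ext _ _ (key h hh)).symm))⟩⟩⟩
  have he : IsNormalEpiCategory (Center C) := ⟨fun {A B} f _ => by
    obtain ⟨g, hg⟩ := exists_section_of_epi hreg hsplit f
    obtain ⟨K, i, p, g', hip, hpi, hif⟩ := exists_center_kernel hreg hsplit f
    have key : ∀ {W : Center C} (h : A ⟶ W), i ≫ h = 0 → f.f ≫ g ≫ h.f = h.f := by
      intro W h hh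
      have h1 : i.f ≫ h.f = 0 := congrArg Center.Hom.f hh
      have h2 : h.f = f.f ≫ g' ≫ h.f := by
        have := congrArg (fun t => t ≫ h.f) hpi
        simp only [h1, comp_zero, Preadditive.sub_comp, Category.id_comp, Category.assoc] at this
        exact sub_eq_zero.1 this.symm
      rw [h2]
      simp [reassoc_of% hg]
    exact ⟨⟨K, i, Center.ext _ _ hif, CokernelCofork.IsColimit.ofπ f _
      (fun {W} h hh => centerDesc f g hg h (g ≫ h.f) (key h hh))
      (fun h hh => Center.ext _ _ (key h hh))
      (fun h hh m hm => (cancel_epi f).1 (hm.trans (Center.ext _ _ (key h hh)).symm))⟩⟩⟩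
  exact ⟨{ (inferInstance : Preadditive (Center C)), hm, he with }, rfl⟩

end Center
end FusionCenter

namespace FusionCenter

/-! ### The center is rigid -/

section Rigid

variable {C : Type u} [Category.{v} C] [MonoidalCategory C]

/-- In the presence of left duals, the invertibility of a half braiding is automatic. -/
def _root_.CategoryTheory.HalfBraiding.ofLax {A : C} (θ : ∀ X, A ⊗ X ⟶ X ⊗ A)
    (unit : θ (𝟙_ C) = (ρ_ A).hom ≫ (λ_ A).inv)
    (monoidal : ∀ U V, θ (U ⊗ V) =
      (α_ _ _ _).inv ≫ θ U ▷ V ≫ (α_ _ _ _).hom ≫ U ◁ θ V ≫ (α_ _ _ _).inv)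
    (naturality : ∀ {U V} (f : U ⟶ V), A ◁ f ≫ θ V = θ U ≫ f ▷ A)
    (L : C → C) (P : ∀ X, ExactPairing (L X) X) : HalfBraiding A where
  β X :=
    { hom := θ X
      -- The inverse is the mate of `θ (L X)`. Multiplicativity merges `θ X` and `θ (L X)` into `θ`
      -- of their tensor product, naturality along the evaluation or coevaluation reduces this to `θ
      -- (𝟙_ C)`, and a zigzag remains.
      inv := 𝟙 _ ⊗≫ (X ⊗ A) ◁ η_ (L X) X ⊗≫ X ◁ θ (L X) ▷ X ⊗≫ ε_ (L X) X ▷ (A ⊗ X) ⊗≫ 𝟙 _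
      hom_inv_id := by
        calc
          _ = 𝟙 _ ⊗≫ (θ X ▷ 𝟙_ C ≫ (X ⊗ A) ◁ η_ (L X) X) ⊗≫ X ◁ θ (L X) ▷ X ⊗≫
              ε_ (L X) X ▷ (A ⊗ X) ⊗≫ 𝟙 _ := by monoidal
          _ = 𝟙 _ ⊗≫ (A ⊗ X) ◁ η_ (L X) X ⊗≫ ((α_ _ _ _).inv ≫ θ X ▷ L X ≫ (α_ _ _ _).hom ≫
              X ◁ θ (L X) ≫ (α_ _ _ _).inv) ▷ X ⊗≫ ε_ (L X) X ▷ (A ⊗ X) ⊗≫ 𝟙 _ := by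
            rw [← whisker_exchange]; monoidal
          _ = 𝟙 _ ⊗≫ (A ⊗ X) ◁ η_ (L X) X ⊗≫ (θ (X ⊗ L X) ≫ ε_ (L X) X ▷ A) ▷ X ⊗≫ 𝟙 _ := by
            rw [← monoidal]; monoidal
          _ = 𝟙 _ ⊗≫ A ◁ (X ◁ η_ (L X) X ⊗≫ ε_ (L X) X ▷ X) ⊗≫ θ (𝟙_ C) ▷ X ⊗≫ 𝟙 _ := by
            rw [← naturality]; monoidal
          _ = _ := by
            rw [ExactPairing.coevaluation_evaluation'', unit]; monoidal
      inv_hom_id := by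
        calc
          _ = 𝟙 _ ⊗≫ (X ⊗ A) ◁ η_ (L X) X ⊗≫ X ◁ θ (L X) ▷ X ⊗≫
              (ε_ (L X) X ▷ (A ⊗ X) ≫ 𝟙_ C ◁ θ X) ⊗≫ 𝟙 _ := by monoidal
          _ = 𝟙 _ ⊗≫ (X ⊗ A) ◁ η_ (L X) X ⊗≫ X ◁ ((α_ _ _ _).inv ≫ θ (L X) ▷ X ≫ (α_ _ _ _).hom ≫
              L X ◁ θ X ≫ (α_ _ _ _).inv) ⊗≫ ε_ (L X) X ▷ (X ⊗ A) ⊗≫ 𝟙 _ := by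
            rw [← whisker_exchange]; monoidal
          _ = 𝟙 _ ⊗≫ X ◁ (A ◁ η_ (L X) X ≫ θ (L X ⊗ X)) ⊗≫ ε_ (L X) X ▷ (X ⊗ A) ⊗≫ 𝟙 _ := by
            rw [← monoidal]; monoidal
          _ = 𝟙 _ ⊗≫ X ◁ θ (𝟙_ C) ⊗≫ (X ◁ η_ (L X) X ⊗≫ ε_ (L X) X ▷ X) ▷ A ⊗≫ 𝟙 _ := by
            rw [naturality]; monoidal
          _ = _ := by
            rw [ExactPairing.coevaluation_evaluation'', unit]; monoidal }
  monoidal := monoidal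
  naturality := naturality

theorem halfBraiding_unit (A : Center C) : (A.2.β (𝟙_ C)).hom = (ρ_ A.1).hom ≫ (λ_ A.1).inv :=
  (congrArg Center.Hom.f (braiding_tensorUnit_right A)).trans
    (congrArg (fun t => (ρ_ A.1).hom ≫ t) (Center.leftUnitor_inv_f A))

variable {A B : C} [ExactPairing A B] (σ : HalfBraiding A)

/-- The half braiding of a right dual, as a family of morphisms. -/
def dualBraiding (X : C) : B ⊗ X ⟶ X ⊗ B :=
  𝟙 _ ⊗≫ (B ⊗ X) ◁ η_ A B ⊗≫ B ◁ (σ.β X).inv ▷ B ⊗≫ ε_ A B ▷ (X ⊗ B) ⊗≫ 𝟙 _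

/-- Together with `dualBraiding_evaluation`, this makes the (co)evaluation of the pairing a morphism
of the center, once composed with `σ.β Y` to cancel the inverse. -/
theorem coevaluation_dualBraiding (Y : C) :
    η_ A B ▷ Y ⊗≫ A ◁ dualBraiding (B := B) σ Y = 𝟙 _ ⊗≫ Y ◁ η_ A B ⊗≫ (σ.β Y).inv ▷ B ⊗≫ 𝟙 _ := by
  calc
    _ = 𝟙 _ ⊗≫ (η_ A B ▷ (Y ⊗ 𝟙_ C) ≫ (A ⊗ B) ◁ (Y ◁ η_ A B)) ⊗≫ A ◁ B ◁ (σ.β Y).inv ▷ B ⊗≫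
        A ◁ ε_ A B ▷ (Y ⊗ B) ⊗≫ 𝟙 _ := by
      rw [dualBraiding]; monoidal
    _ = 𝟙 _ ⊗≫ Y ◁ η_ A B ⊗≫ (η_ A B ▷ ((Y ⊗ A) ⊗ B) ≫ (A ⊗ B) ◁ ((σ.β Y).inv ▷ B)) ⊗≫
        A ◁ ε_ A B ▷ (Y ⊗ B) ⊗≫ 𝟙 _ := by
      rw [← whisker_exchange]; monoidal
    _ = 𝟙 _ ⊗≫ Y ◁ η_ A B ⊗≫ (σ.β Y).inv ▷ B ⊗≫ (η_ A B ▷ A ⊗≫ A ◁ ε_ A B) ▷ (Y ⊗ B) ⊗≫ 𝟙 _ := by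
      rw [← whisker_exchange]; monoidal
    _ = _ := by
      rw [ExactPairing.evaluation_coevaluation'']; monoidal

theorem dualBraiding_evaluation (Y : C) :
    dualBraiding (B := B) σ Y ▷ A ⊗≫ Y ◁ ε_ A B =
      𝟙 _ ⊗≫ B ◁ (σ.β Y).inv ⊗≫ ε_ A B ▷ Y ⊗≫ 𝟙 _ := by
  calc
    _ = 𝟙 _ ⊗≫ (B ⊗ Y) ◁ η_ A B ▷ A ⊗≫ B ◁ (σ.β Y).inv ▷ (B ⊗ A) ⊗≫
        (ε_ A B ▷ (Y ⊗ (B ⊗ A)) ≫ 𝟙_ C ◁ (Y ◁ ε_ A B)) ⊗≫ 𝟙 _ := by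
      rw [dualBraiding]; monoidal
    _ = 𝟙 _ ⊗≫ (B ⊗ Y) ◁ η_ A B ▷ A ⊗≫ B ◁ ((σ.β Y).inv ▷ (B ⊗ A) ≫ (A ⊗ Y) ◁ ε_ A B) ⊗≫
        ε_ A B ▷ Y ⊗≫ 𝟙 _ := by
      rw [← whisker_exchange]; monoidal
    _ = 𝟙 _ ⊗≫ (B ⊗ Y) ◁ (η_ A B ▷ A ⊗≫ A ◁ ε_ A B) ⊗≫ B ◁ (σ.β Y).inv ⊗≫
        ε_ A B ▷ Y ⊗≫ 𝟙 _ := by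
      rw [← whisker_exchange]; monoidal
    _ = _ := by
      rw [ExactPairing.evaluation_coevaluation'']; monoidal

theorem dualBraiding_unit : dualBraiding (B := B) σ (𝟙_ C) = (ρ_ B).hom ≫ (λ_ B).inv := by
  have h : (σ.β (𝟙_ C)).inv = (λ_ A).hom ≫ (ρ_ A).inv := by
    rw [← cancel_epi (σ.β (𝟙_ C)).hom, Iso.hom_inv_id,
      show (σ.β (𝟙_ C)).hom = _ from halfBraiding_unit ⟨A, σ⟩]
    simp
  calc
    _ = 𝟙 _ ⊗≫ (B ◁ η_ A B ⊗≫ ε_ A B ▷ B) ⊗≫ 𝟙 _ := by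
      rw [dualBraiding, h]; monoidal
    _ = _ := by
      rw [ExactPairing.coevaluation_evaluation'']; monoidal

theorem dualBraiding_naturality {U V : C} (f : U ⟶ V) :
    B ◁ f ≫ dualBraiding (B := B) σ V = dualBraiding σ U ≫ f ▷ B := by
  have h : f ▷ A ≫ (σ.β V).inv = (σ.β U).inv ≫ A ◁ f := by
    rw [Iso.comp_inv_eq, Category.assoc, σ.naturality, Iso.inv_hom_id_assoc]
  calc
    _ = 𝟙 _ ⊗≫ B ◁ (f ▷ 𝟙_ C ≫ V ◁ η_ A B) ⊗≫ B ◁ (σ.β V).inv ▷ B ⊗≫ ε_ A B ▷ (V ⊗ B) ⊗≫ 𝟙 _ := by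
      rw [dualBraiding]; monoidal
    _ = 𝟙 _ ⊗≫ (B ⊗ U) ◁ η_ A B ⊗≫ B ◁ (f ▷ A ≫ (σ.β V).inv) ▷ B ⊗≫
        ε_ A B ▷ (V ⊗ B) ⊗≫ 𝟙 _ := by
      rw [← whisker_exchange]; monoidal
    _ = 𝟙 _ ⊗≫ (B ⊗ U) ◁ η_ A B ⊗≫ B ◁ (σ.β U).inv ▷ B ⊗≫
        ((B ⊗ A) ◁ (f ▷ B) ≫ ε_ A B ▷ (V ⊗ B)) ⊗≫ 𝟙 _ := by
      rw [h]; monoidal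
    _ = _ := by
      rw [whisker_exchange, dualBraiding]; monoidal

theorem dualBraiding_tensor (U V : C) : dualBraiding (B := B) σ (U ⊗ V) =
    (α_ _ _ _).inv ≫ dualBraiding σ U ▷ V ≫ (α_ _ _ _).hom ≫ U ◁ dualBraiding σ V ≫
      (α_ _ _ _).inv := by
  have h : (σ.β (U ⊗ V)).inv = (α_ _ _ _).hom ≫ U ◁ (σ.β V).inv ≫ (α_ _ _ _).inv ≫
      (σ.β U).inv ▷ V ≫ (α_ _ _ _).hom := by
    rw [← cancel_epi (σ.β (U ⊗ V)).hom, Iso.hom_inv_id, σ.monoidal]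
    simp
  symm
  calc
    _ = 𝟙 _ ⊗≫ (B ⊗ U) ◁ η_ A B ▷ V ⊗≫ B ◁ (σ.β U).inv ▷ B ▷ V ⊗≫
        (ε_ A B ▷ (U ⊗ (B ⊗ V)) ≫ 𝟙_ C ◁ (U ◁ dualBraiding (B := B) σ V)) ⊗≫ 𝟙 _ := by
      conv_lhs => rw [dualBraiding]
      monoidal
    _ = 𝟙 _ ⊗≫ (B ⊗ U) ◁ η_ A B ▷ V ⊗≫ B ◁ ((σ.β U).inv ▷ (B ⊗ V) ≫
        (A ⊗ U) ◁ dualBraiding (B := B) σ V) ⊗≫ ε_ A B ▷ (U ⊗ (V ⊗ B)) ⊗≫ 𝟙 _ := by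
      rw [← whisker_exchange]; monoidal
    _ = 𝟙 _ ⊗≫ (B ⊗ U) ◁ (η_ A B ▷ V ⊗≫ A ◁ dualBraiding (B := B) σ V) ⊗≫ B ◁ (σ.β U).inv ▷ (V ⊗ B) ⊗≫
        ε_ A B ▷ (U ⊗ (V ⊗ B)) ⊗≫ 𝟙 _ := by
      rw [← whisker_exchange]; monoidal
    _ = _ := by
      rw [coevaluation_dualBraiding, dualBraiding, h]; monoidal

end Rigid

section

variable {C : Type u} [Category.{v} C] [MonoidalCategory C]

/-- The right dual of an object of the center. -/
@[reducible]
def centerRightDual (L : C → C) (P : ∀ X, ExactPairing (L X) X) (A : Center C) (B : C)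
    [ExactPairing A.1 B] : HasRightDual A :=
  let B' : Center C := ⟨B, HalfBraiding.ofLax (dualBraiding A.2) (dualBraiding_unit A.2)
    (dualBraiding_tensor A.2) (dualBraiding_naturality A.2) L P⟩
  { rightDual := B'
    exact :=
      { coevaluation' := ⟨η_ A.1 B, fun U => by
          simp only [Center.tensor_β, Center.tensorUnit_β]
          change η_ A.1 B ▷ U ≫ (α_ _ _ _).hom ≫ A.1 ◁ dualBraiding A.2 U ≫ (α_ _ _ _).inv ≫
            (A.2.β U).hom ▷ B ≫ (α_ _ _ _).hom = ((λ_ U).hom ≫ (ρ_ U).inv) ≫ U ◁ η_ A.1 B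
          calc
            _ = 𝟙 _ ⊗≫ (η_ A.1 B ▷ U ⊗≫ A.1 ◁ dualBraiding (B := B) A.2 U) ⊗≫
                (A.2.β U).hom ▷ B ⊗≫ 𝟙 _ := by monoidal
            _ = 𝟙 _ ⊗≫ U ◁ η_ A.1 B ⊗≫ ((A.2.β U).inv ≫ (A.2.β U).hom) ▷ B ⊗≫ 𝟙 _ := by
              rw [coevaluation_dualBraiding]; monoidal
            _ = _ := by rw [Iso.inv_hom_id]; monoidal⟩
        evaluation' := ⟨ε_ A.1 B, fun U => by
          simp only [Center.tensor_β, Center.tensorUnit_β]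
          change ε_ A.1 B ▷ U ≫ (λ_ U).hom ≫ (ρ_ U).inv = ((α_ _ _ _).hom ≫ B ◁ (A.2.β U).hom ≫
            (α_ _ _ _).inv ≫ dualBraiding A.2 U ▷ A.1 ≫ (α_ _ _ _).hom) ≫ U ◁ ε_ A.1 B
          symm
          calc
            _ = 𝟙 _ ⊗≫ B ◁ (A.2.β U).hom ⊗≫ (dualBraiding (B := B) A.2 U ▷ A.1 ⊗≫
                U ◁ ε_ A.1 B) ⊗≫ 𝟙 _ := by monoidal
            _ = 𝟙 _ ⊗≫ B ◁ ((A.2.β U).hom ≫ (A.2.β U).inv) ⊗≫ ε_ A.1 B ▷ U ⊗≫ 𝟙 _ := by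
              rw [dualBraiding_evaluation]; monoidal
            _ = _ := by rw [Iso.hom_inv_id]; monoidal⟩
        coevaluation_evaluation' := Center.ext _ _ (by
          simp only [Center.comp_f, Center.whiskerLeft_f, Center.whiskerRight_f,
            Center.associator_inv_f, Center.rightUnitor_hom_f, Center.leftUnitor_inv_f]
          exact ExactPairing.coevaluation_evaluation A.1 B)
        evaluation_coevaluation' := Center.ext _ _ (by
          simp only [Center.comp_f, Center.whiskerLeft_f, Center.whiskerRight_f,
            Center.associator_hom_f, Center.leftUnitor_hom_f, Center.rightUnitor_inv_f]
          exact ExactPairing.evaluation_coevaluation A.1 B) } }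

/-- The center of a category with left and right duals is rigid. -/
@[reducible]
noncomputable def centerRigid (L R : C → C) (P : ∀ X, ExactPairing (L X) X) (Q : ∀ X, ExactPairing X (R X)) :
    RigidCategory (Center C) :=
  letI : RightRigidCategory (Center C) :=
    { rightDual := fun A => letI := Q A.1; centerRightDual L P A (R A.1) }
  -- The center is braided, so right duals are also left duals.
  BraidedCategory.rigidCategoryOfRightRigidCategory

end

end FusionCenter

namespace FusionCenter

/-! ### The right adjoint of the forgetful functor -/

section Cofree

variable {C : Type u} [Category.{v} C] [MonoidalCategory C]

/-- A natural family `u V : R ⊗ V ⟶ V ⊗ X` is cofree if, for every `W`, the induced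
family `(W ⊗ R) ⊗ V ⟶ W ⊗ (V ⊗ X)` is universal among the natural families
`Y ⊗ V ⟶ W ⊗ (V ⊗ X)`. -/
structure IsCofree {X R : C} (u : ∀ V, R ⊗ V ⟶ V ⊗ X) : Prop where
  naturality : ∀ {V V' : C} (f : V ⟶ V'), R ◁ f ≫ u V' = u V ≫ f ▷ X
  exists_lift : ∀ {Y W : C} (φ : ∀ V, Y ⊗ V ⟶ W ⊗ (V ⊗ X))
    (_ : ∀ {V V' : C} (f : V ⟶ V'), Y ◁ f ≫ φ V' = φ V ≫ W ◁ f ▷ X),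
    ∃ a : Y ⟶ W ⊗ R, ∀ V, a ▷ V ≫ (α_ W R V).hom ≫ W ◁ u V = φ V
  hom_ext : ∀ {Y W : C} (a b : Y ⟶ W ⊗ R), (∀ V, a ▷ V ≫ (α_ W R V).hom ≫ W ◁ u V =
    b ▷ V ≫ (α_ W R V).hom ≫ W ◁ u V) → a = b

/-- `R` is the end of `V ↦ (V ⊗ X) ⊗ V*`, which semisimplicity turns into a finite sum over the `s
i`. A natural family is determined by its components at the `s i`, which are arbitrary, and duality
turns a component `Y ⊗ s i ⟶ W ⊗ (s i ⊗ X)` into a morphism `Y ⟶ W ⊗ ((s i ⊗ X) ⊗ d i)`. -/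
theorem exists_isCofree {k : Type w} [Field k] [Preadditive C] [Linear k C] [MonoidalPreadditive C]
    [MonoidalLinear k C] [HasFiniteBiproducts C] {I : Type*} [Fintype I] {s : I → C}
    (hs : IsSimpleSystem k s) (d : I → C) (P : ∀ i, ExactPairing (s i) (d i)) (X : C) :
    ∃ (R : C) (u : ∀ V, R ⊗ V ⟶ V ⊗ X), IsCofree u := by
  let F : I → C := fun i => (s i ⊗ X) ⊗ d i
  obtain ⟨u', hu'⟩ := hs.exists_natTrans (tensorLeft (⨁ F)) (tensorRight X)
    (fun i => biproduct.π F i ▷ s i ≫ (α_ _ _ _).hom ≫ (s i ⊗ X) ◁ ε_ (s i) (d i) ≫ (ρ_ _).hom)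
  let u : ∀ V, (⨁ F) ⊗ V ⟶ V ⊗ X := u'.app
  have hnat : ∀ {V V' : C} (f : V ⟶ V'), (⨁ F) ◁ f ≫ u V' = u V ≫ f ▷ X := fun f => u'.naturality f
  have hu : ∀ i, u (s i) = biproduct.π F i ▷ s i ≫ (α_ _ _ _).hom ≫
    (s i ⊗ X) ◁ ε_ (s i) (d i) ≫ (ρ_ _).hom := hu'
  clear_value u
  have hu' : ∀ {Y W : C} (a : Y ⟶ W ⊗ ⨁ F) i, a ▷ s i ≫ (α_ _ _ _).hom ≫ W ◁ u (s i) =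
      (a ≫ W ◁ biproduct.π F i) ▷ s i ⊗≫ (W ⊗ (s i ⊗ X)) ◁ ε_ (s i) (d i) ⊗≫ 𝟙 _ := by
    intro Y W a i
    rw [hu]
    dsimp only [F]
    monoidal
  refine ⟨⨁ F, u, hnat, fun {Y W} φ hφ => ?_, fun {Y W} a b h => ?_⟩
  -- `t i` is `φ (s i)` with the strand `s i` bent to the target; it is the `i`-th component of the
  -- lift.
  · let t : ∀ i, Y ⟶ W ⊗ F i := fun i =>
      𝟙 _ ⊗≫ Y ◁ η_ (s i) (d i) ⊗≫ φ (s i) ▷ d i ⊗≫ 𝟙 _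
    let a : Y ⟶ W ⊗ ⨁ F := ∑ i, t i ≫ W ◁ biproduct.ι F i
    have ha : ∀ i, a ≫ W ◁ biproduct.π F i = t i := by
      intro i
      classical
      rw [Preadditive.sum_comp, Finset.sum_eq_single i]
      · rw [Category.assoc, ← MonoidalCategory.whiskerLeft_comp, biproduct.ι_π_self]
        simp
      · intro j _ hj
        rw [Category.assoc, ← MonoidalCategory.whiskerLeft_comp, biproduct.ι_π_ne _ hj]
        simp
      · simp
    let φ' : tensorLeft Y ⟶ tensorRight X ⋙ tensorLeft W :=
      { app := φ
        naturality := fun _ _ f => hφ f }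
    let ψ : tensorLeft Y ⟶ tensorRight X ⋙ tensorLeft W :=
      { app := fun V => a ▷ V ≫ (α_ _ _ _).hom ≫ W ◁ u V
        naturality := fun V V' f => by
          change Y ◁ f ≫ a ▷ V' ≫ (α_ _ _ _).hom ≫ W ◁ u V' =
            (a ▷ V ≫ (α_ _ _ _).hom ≫ W ◁ u V) ≫ W ◁ f ▷ X
          have h1 := congrArg (fun t => W ◁ t) (hnat f)
          simp only [MonoidalCategory.whiskerLeft_comp] at h1
          rw [whisker_exchange_assoc]
          simp [h1] }
    have hψ : ψ = φ' := hs.natTrans_ext fun i => by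
      change a ▷ s i ≫ (α_ _ _ _).hom ≫ W ◁ u (s i) = φ (s i)
      rw [hu', ha]
      calc
        _ = 𝟙 _ ⊗≫ Y ◁ η_ (s i) (d i) ▷ s i ⊗≫ (φ (s i) ▷
              (d i ⊗ s i) ≫ (W ⊗ (s i ⊗ X)) ◁ ε_ (s i) (d i)) ⊗≫ 𝟙 _ := by
          dsimp only [t]; monoidal
        _ = 𝟙 _ ⊗≫ Y ◁ (η_ (s i) (d i) ▷ s i ⊗≫ s i ◁ ε_ (s i) (d i)) ⊗≫
              φ (s i) ⊗≫ 𝟙 _ := by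
          rw [← whisker_exchange]; monoidal
        _ = _ := by
          rw [ExactPairing.evaluation_coevaluation'']; monoidal
    exact ⟨a, fun V => congrArg (fun t => t.app V) hψ⟩
  · have key : ∀ (c : Y ⟶ W ⊗ ⨁ F) i, c ≫ W ◁ biproduct.π F i = 𝟙 _ ⊗≫ Y ◁ η_ (s i) (d i) ⊗≫
        (c ▷ s i ≫ (α_ _ _ _).hom ≫ W ◁ u (s i)) ▷ d i ⊗≫ 𝟙 _ := by
      intro c i
      rw [hu']
      generalize c ≫ W ◁ biproduct.π F i = c'
      symm
      calc
        _ = 𝟙 _ ⊗≫ (Y ◁ η_ (s i) (d i) ≫ c' ▷ (s i ⊗ d i)) ⊗≫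
            (W ⊗ (s i ⊗ X)) ◁ ε_ (s i) (d i) ▷ d i ⊗≫ 𝟙 _ := by monoidal
        _ = 𝟙 _ ⊗≫ c' ⊗≫ (W ⊗ (s i ⊗ X)) ◁ (d i ◁ η_ (s i) (d i) ⊗≫ ε_ (s i) (d i) ▷ d i) ⊗≫
            𝟙 _ := by
          rw [whisker_exchange]; monoidal
        _ = _ := by
          rw [ExactPairing.coevaluation_evaluation'']; monoidal
    have hab : ∀ i, a ≫ W ◁ biproduct.π F i = b ≫ W ◁ biproduct.π F i := fun i => by
      rw [key, key, h]
    have hid : ∑ i, W ◁ biproduct.π F i ≫ W ◁ biproduct.ι F i = 𝟙 (W ⊗ ⨁ F) := by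
      simp only [← MonoidalCategory.whiskerLeft_comp, ← whiskerLeft_sum]
      exact (congrArg (fun t => W ◁ t) (IsBilimit.total (biproduct.isBilimit F))).trans (MonoidalCategory.whiskerLeft_id _ _)
    rw [← Category.comp_id a, ← Category.comp_id b, ← hid]
    simp only [Preadditive.comp_sum, ← Category.assoc, hab]

namespace IsCofree

variable {X R : C} {u : ∀ V, R ⊗ V ⟶ V ⊗ X} (hu : IsCofree u)
include hu

theorem exists_lift' {Y : C} (φ : ∀ V, Y ⊗ V ⟶ V ⊗ X)
    (hφ : ∀ {V V'} (f : V ⟶ V'), Y ◁ f ≫ φ V' = φ V ≫ f ▷ X) :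
    ∃ a : Y ⟶ R, ∀ V, a ▷ V ≫ u V = φ V := by
  obtain ⟨a, ha⟩ := hu.exists_lift (Y := Y) (W := 𝟙_ C) (fun V => φ V ≫ (λ_ _).inv)
    (fun f => by simp [reassoc_of% hφ f])
  refine ⟨a ≫ (λ_ R).hom, fun V => ?_⟩
  have := ha V
  rw [← cancel_mono (λ_ _).inv, ← this]
  simp

theorem hom_ext' {Y : C} (a b : Y ⟶ R) (h : ∀ V, a ▷ V ≫ u V = b ▷ V ≫ u V) : a = b := by
  rw [← cancel_mono (λ_ R).inv]
  refine hu.hom_ext _ _ fun V => ?_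
  have e : ∀ c : Y ⟶ R, (c ≫ (λ_ R).inv) ▷ V ≫ (α_ (𝟙_ C) R V).hom ≫ 𝟙_ C ◁ u V =
      (c ▷ V ≫ u V) ≫ (λ_ _).inv := by
    intro c
    simp
  rw [e, e, h]

/-- The family `u (W ⊗ V)`, regarded as natural in `V` only, lifts through `W ⊗ R`; this is why
universality is required with the extra factor `W`. The half braiding axioms then follow from
uniqueness of lifts. -/
theorem exists_braiding (W : C) : ∃ a : R ⊗ W ⟶ W ⊗ R, ∀ V, a ▷ V ≫ (α_ W R V).hom ≫ W ◁ u V =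
    (α_ _ _ _).hom ≫ u (W ⊗ V) ≫ (α_ W V X).hom :=
  hu.exists_lift (fun V => (α_ R W V).hom ≫ u (W ⊗ V) ≫ (α_ W V X).hom) fun {V V'} f => by
    have := hu.naturality (W ◁ f)
    simp [reassoc_of% this]

/-- The half braiding of a cofree object, as a family of morphisms. -/
noncomputable def braiding (W : C) : R ⊗ W ⟶ W ⊗ R := (hu.exists_braiding W).choose

theorem braiding_spec (W V : C) : hu.braiding W ▷ V ≫ (α_ W R V).hom ≫ W ◁ u V =
    (α_ _ _ _).hom ≫ u (W ⊗ V) ≫ (α_ W V X).hom :=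
  (hu.exists_braiding W).choose_spec V

theorem braiding_unit : hu.braiding (𝟙_ C) = (ρ_ R).hom ≫ (λ_ R).inv := by
  refine hu.hom_ext _ _ fun V => ?_
  rw [hu.braiding_spec]
  have h : u (𝟙_ C ⊗ V) = R ◁ (λ_ V).hom ≫ u V ≫ (λ_ V).inv ▷ X := by
    rw [reassoc_of% hu.naturality (λ_ V).hom]
    simp
  simp [h]

theorem braiding_naturality {W W' : C} (f : W ⟶ W') :
    R ◁ f ≫ hu.braiding W' = hu.braiding W ≫ f ▷ R := by
  refine hu.hom_ext _ _ fun V => ?_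
  have h1 := hu.naturality (f ▷ V)
  have h2 := hu.braiding_spec W V
  have h3 := hu.braiding_spec W' V
  calc
    _ = (R ◁ f) ▷ V ≫ (hu.braiding W' ▷ V ≫ (α_ W' R V).hom ≫ W' ◁ u V) := by simp
    _ = (α_ _ _ _).hom ≫ (R ◁ (f ▷ V) ≫ u (W' ⊗ V)) ≫ (α_ W' V X).hom := by rw [h3]; simp
    _ = (hu.braiding W ▷ V ≫ (α_ W R V).hom ≫ W ◁ u V) ≫ f ▷ (V ⊗ X) := by rw [h1, h2]; simp
    _ = _ := by rw [Category.assoc, Category.assoc, whisker_exchange]; simp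

theorem braiding_tensor (W W' : C) : hu.braiding (W ⊗ W') =
    (α_ _ _ _).inv ≫ hu.braiding W ▷ W' ≫ (α_ _ _ _).hom ≫ W ◁ hu.braiding W' ≫
      (α_ _ _ _).inv := by
  refine hu.hom_ext _ _ fun V => ?_
  have h1 := hu.naturality (α_ W W' V).hom
  rw [hu.braiding_spec]
  symm
  calc
    _ = (α_ _ _ _).inv ▷ V ≫ hu.braiding W ▷ W' ▷ V ≫ 𝟙 _ ⊗≫
        W ◁ (hu.braiding W' ▷ V ≫ (α_ W' R V).hom ≫ W' ◁ u V) ⊗≫ 𝟙 _ := by monoidal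
    _ = 𝟙 _ ⊗≫ (hu.braiding W ▷ (W' ⊗ V) ≫ (α_ _ _ _).hom ≫ W ◁ u (W' ⊗ V)) ⊗≫ 𝟙 _ := by
      rw [hu.braiding_spec]; monoidal
    _ = 𝟙 _ ⊗≫ (u (W ⊗ W' ⊗ V) ≫ (α_ _ _ _).inv ▷ X) ⊗≫ 𝟙 _ := by
      rw [hu.braiding_spec]; monoidal
    _ = _ := by
      rw [← hu.naturality]; monoidal

/-- A cofree object with its half braiding. -/
noncomputable def center (L : C → C) (P : ∀ X, ExactPairing (L X) X) : Center C :=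
  ⟨R, HalfBraiding.ofLax hu.braiding hu.braiding_unit hu.braiding_tensor hu.braiding_naturality L P⟩

/-- The adjunction: `g : A ⟶ X` in `C` corresponds to the natural family that braids `A` past `V`
and then applies `g`. Compatibility with half braidings is the multiplicativity of that of `A`. -/
theorem exists_center_lift (L : C → C) (P : ∀ X, ExactPairing (L X) X) (A : Center C)
    (g : A.1 ⟶ X) :
    ∃ a : A ⟶ hu.center L P, ∀ V, a.f ▷ V ≫ u V = (A.2.β V).hom ≫ V ◁ g := by
  obtain ⟨a, ha⟩ := hu.exists_lift' (fun V => (A.2.β V).hom ≫ V ◁ g) fun {V V'} f => by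
    rw [HalfBraiding.naturality_assoc, Category.assoc, whisker_exchange]
  refine ⟨⟨a, fun U => ?_⟩, ha⟩
  change a ▷ U ≫ hu.braiding U = (A.2.β U).hom ≫ U ◁ a
  refine hu.hom_ext _ _ fun V => ?_
  calc
    _ = a ▷ U ▷ V ≫ (hu.braiding U ▷ V ≫ (α_ _ _ _).hom ≫ U ◁ u V) := by simp
    _ = (α_ _ _ _).hom ≫ (a ▷ (U ⊗ V) ≫ u (U ⊗ V)) ≫ (α_ _ _ _).hom := by
      rw [hu.braiding_spec]; simp
    _ = (A.2.β U).hom ▷ V ≫ (α_ _ _ _).hom ≫ U ◁ (a ▷ V ≫ u V) := by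
      rw [ha, ha]; simp
    _ = _ := by simp

end IsCofree

end Cofree

end FusionCenter

namespace FusionCenter

/-! ### Zigzag identities and closed loops -/

section Zigzag

variable {C : Type u} [Category.{v} C] [MonoidalCategory C] [PivotalCategory C]

open PivotalCategory

theorem lcoev_lev' (X : C) : lcoev X ▷ X ⊗≫ X ◁ lev X = ⊗𝟙.hom :=
  @ExactPairing.evaluation_coevaluation'' _ _ _ X (dual X) (leftPairing X)

theorem rcoev_rev (X : C) : X ◁ rcoev X ⊗≫ rev X ▷ X = ⊗𝟙.hom :=
  @ExactPairing.coevaluation_evaluation'' _ _ _ (dual X) X (rightPairing X)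

theorem rcoev_rev' (X : C) : rcoev X ▷ dual X ⊗≫ dual X ◁ rev X = ⊗𝟙.hom :=
  @ExactPairing.evaluation_coevaluation'' _ _ _ (dual X) X (rightPairing X)

theorem eq_of_lcoev {W X Z : C} {f g : dual W ⊗ X ⟶ Z}
    (h : lcoev W ▷ X ≫ (α_ _ _ _).hom ≫ W ◁ f = lcoev W ▷ X ≫ (α_ _ _ _).hom ≫ W ◁ g) : f = g :=
  letI := leftPairing W
  (tensorLeftHomEquiv X W (dual W) Z).injective (congrArg (fun t => (λ_ X).inv ≫ t) h)

theorem eq_of_rev {W X Z : C} {f g : X ⟶ dual W ⊗ Z}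
    (h : W ◁ f ≫ (α_ _ _ _).inv ≫ rev W ▷ Z = W ◁ g ≫ (α_ _ _ _).inv ≫ rev W ▷ Z) : f = g :=
  letI := rightPairing W
  (tensorLeftHomEquiv X (dual W) W Z).symm.injective (by
    have := congrArg (fun t => t ≫ (λ_ Z).hom) h
    simp only [Category.assoc] at this
    exact this)

/-- The endomorphism of `V` obtained from an endomorphism of `W* ⊗ V` by closing the strand `W`. -/
def loop (W V : C) (f : dual W ⊗ V ⟶ dual W ⊗ V) : V ⟶ V :=
  𝟙 _ ⊗≫ lcoev W ▷ V ⊗≫ W ◁ f ⊗≫ rev W ▷ V ⊗≫ 𝟙 _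

theorem loop_naturality (W : C) {V V' : C} (f : V ⟶ V')
    {g : dual W ⊗ V ⟶ dual W ⊗ V} {g' : dual W ⊗ V' ⟶ dual W ⊗ V'}
    (h : dual W ◁ f ≫ g' = g ≫ dual W ◁ f) : f ≫ loop W V' g' = loop W V g ≫ f := by
  calc
    _ = 𝟙 _ ⊗≫ (𝟙_ C ◁ f ≫ lcoev W ▷ V') ⊗≫ W ◁ g' ⊗≫ rev W ▷ V' ⊗≫ 𝟙 _ := by
      rw [loop]; monoidal
    _ = 𝟙 _ ⊗≫ lcoev W ▷ V ⊗≫ W ◁ (dual W ◁ f ≫ g') ⊗≫ rev W ▷ V' ⊗≫ 𝟙 _ := by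
      rw [whisker_exchange]; monoidal
    _ = 𝟙 _ ⊗≫ lcoev W ▷ V ⊗≫ W ◁ g ⊗≫ ((W ⊗ dual W) ◁ f ≫ rev W ▷ V') ⊗≫ 𝟙 _ := by
      rw [h]; monoidal
    _ = _ := by
      rw [whisker_exchange, loop]; monoidal

end Zigzag

/-! ### Semisimplicity of the center forces a nonzero dimension -/

section Cofree

open PivotalCategory

variable {C : Type u} [Category.{v} C] [MonoidalCategory C] [PivotalCategory C]
  {k : Type w} [Field k] [Preadditive C] [Linear k C] [MonoidalPreadditive C] [MonoidalLinear k C]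

namespace IsCofree

variable {R : C} {u : ∀ V, R ⊗ V ⟶ V ⊗ 𝟙_ C} (hu : IsCofree u)
include hu

/-- `b` is `a` encircled by a strand `W` by means of the half braiding of `R`. Seen through `u`, it
encircles `φ`. Seen through `r`, which `hr` makes a morphism of the center to the unit, the strand
detaches as a closed loop of value `dim_r(W)`. -/
theorem exists_loop_lift {φ : ∀ V : C, V ⟶ V} {a : 𝟙_ C ⟶ R}
    (ha : ∀ V, a ▷ V ≫ u V = (λ_ V).hom ≫ φ V ≫ (ρ_ V).inv) {r : R ⟶ 𝟙_ C}
    (hr : ∀ W, r ▷ W ≫ (λ_ W).hom ≫ (ρ_ W).inv = hu.braiding W ≫ W ◁ r) {c : k}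
    (hc : a ≫ r = c • 𝟙 _) (W : C) :
    ∃ b : 𝟙_ C ⟶ R, (∀ V, b ▷ V ≫ u V = (λ_ V).hom ≫ loop W V (φ _) ≫ (ρ_ V).inv) ∧
      b ≫ r = c • rightDim W := by
  refine ⟨lcoev W ⊗≫ W ◁ (a ▷ dual W ≫ hu.braiding (dual W)) ⊗≫ rev W ▷ R ⊗≫ 𝟙 _,
    fun V => ?_, ?_⟩
  · calc
      _ = 𝟙 _ ⊗≫ lcoev W ▷ V ⊗≫ W ◁ (a ▷ dual W ≫ hu.braiding (dual W)) ▷ V ⊗≫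
          (rev W ▷ (R ⊗ V) ≫ 𝟙_ C ◁ u V) ⊗≫ 𝟙 _ := by monoidal
      _ = 𝟙 _ ⊗≫ lcoev W ▷ V ⊗≫ W ◁ a ▷ dual W ▷ V ⊗≫ W ◁ (hu.braiding (dual W) ▷ V ≫
          (α_ _ _ _).hom ≫ dual W ◁ u V) ⊗≫ rev W ▷ V ⊗≫ 𝟙 _ := by
        rw [← whisker_exchange]; monoidal
      _ = 𝟙 _ ⊗≫ lcoev W ▷ V ⊗≫ W ◁ (a ▷ (dual W ⊗ V) ≫ u (dual W ⊗ V)) ⊗≫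
          rev W ▷ V ⊗≫ 𝟙 _ := by
        rw [hu.braiding_spec]; monoidal
      _ = _ := by
        rw [ha, loop]; monoidal
  · calc
      _ = 𝟙 _ ⊗≫ lcoev W ⊗≫ W ◁ (a ▷ dual W ≫ hu.braiding (dual W)) ⊗≫
          (rev W ▷ R ≫ 𝟙_ C ◁ r) ⊗≫ 𝟙 _ := by monoidal
      _ = 𝟙 _ ⊗≫ lcoev W ⊗≫ W ◁ (a ▷ dual W ≫ hu.braiding (dual W) ≫ dual W ◁ r) ⊗≫
          rev W ⊗≫ 𝟙 _ := by
        rw [← whisker_exchange]; monoidal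
      _ = 𝟙 _ ⊗≫ lcoev W ⊗≫ W ◁ ((a ≫ r) ▷ dual W ≫ (λ_ _).hom ≫ (ρ_ _).inv) ⊗≫
          rev W ⊗≫ 𝟙 _ := by
        rw [← hr]; monoidal
      _ = c • (𝟙 _ ⊗≫ lcoev W ⊗≫ W ◁ ((𝟙 _) ▷ dual W ≫ (λ_ _).hom ≫ (ρ_ _).inv) ⊗≫
          rev W ⊗≫ 𝟙 _) := by
        rw [hc]
        simp [monoidalComp]
      _ = _ := by
        rw [rightDim, rightTrace]
        congr 1
        monoidal

end IsCofree

namespace IsSimpleSystem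

variable {I : Type*} [Fintype I] {s : I → C} (hs : IsSimpleSystem k s)
include hs

variable (k) in
omit [MonoidalCategory C] [PivotalCategory C] [MonoidalPreadditive C] [MonoidalLinear k C] in
/-- The natural projections onto the isotypic components. -/
theorem exists_isotypic (i : I) : ∃ p : 𝟭 C ⟶ 𝟭 C, p.app (s i) = 𝟙 (s i) ∧
    ∀ j, j ≠ i → p.app (s j) = 0 := by
  classical
  obtain ⟨p, hp⟩ := hs.exists_natTrans (𝟭 C) (𝟭 C) (fun j => if j = i then 𝟙 _ else 0)
  exact ⟨p, by simpa using hp i, fun j hj => by simpa [hj] using hp j⟩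

omit [MonoidalCategory C] [PivotalCategory C] [MonoidalPreadditive C] [MonoidalLinear k C] in
theorem exists_isotypic_eq_sum {i : I} {p : 𝟭 C ⟶ 𝟭 C} (h1 : p.app (s i) = 𝟙 (s i))
    (h2 : ∀ j, j ≠ i → p.app (s j) = 0) (V : C) :
    ∃ (n : ℕ) (x : Fin n → (V ⟶ s i)) (y : Fin n → (s i ⟶ V)), p.app V = ∑ a, x a ≫ y a := by
  classical
  obtain ⟨n, π, ι, hV⟩ := hs.complete V
  refine ⟨n i, π i, ι i, ?_⟩
  have e : p.app V = (∑ j, ∑ a, π j a ≫ ι j a) ≫ p.app V := by rw [hV]; exact (Category.id_comp _).symm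
  have nat : ∀ {j} (x : s j ⟶ V), x ≫ p.app V = p.app (s j) ≫ x := fun x => p.naturality x
  rw [e]
  simp only [Preadditive.sum_comp, Category.assoc, nat]
  rw [Finset.sum_eq_single i]
  · simp [h1]
  · intro j _ hj
    simp [h2 j hj]
  · simp

omit [MonoidalCategory C] [PivotalCategory C] [MonoidalPreadditive C] [MonoidalLinear k C] in
theorem exists_iso {X : C} (hX : IsScalar k X) : ∃ i, Nonempty (X ≅ s i) := by
  have : ∃ (i : I) (x : s i ⟶ X), x ≠ 0 := by
    by_contra! h
    exact hX.id_ne_zero (hs.hom_ext fun i x => by simp [h i x])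
  obtain ⟨i, x, hx⟩ := this
  obtain ⟨y, hy⟩ := hs.exists_retraction x hx
  obtain ⟨c, hc⟩ := hX.exists_smul (y ≫ x)
  have h1 : c = 1 := by
    have h2 : x ≫ y ≫ x = c • x := by rw [hc]; simp
    rw [← Category.assoc, hy, Category.id_comp] at h2
    by_contra h3
    have h4 : (1 - c) • x = 0 := by rw [sub_smul, one_smul, ← h2, sub_self]
    rcases smul_eq_zero.1 h4 with h | h
    · exact h3 (sub_eq_zero.1 h).symm
    · exact hx h
  exact ⟨i, ⟨⟨y, x, by rw [hc, h1, one_smul], hy⟩⟩⟩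

/-- The closed loop around the projection onto the unit component is, up to the left dimension,
the projection onto the component dual to the strand of the loop. -/
theorem leftDim_smul_loop (h1 : IsScalar k (𝟙_ C)) {o : I} (e : 𝟙_ C ≅ s o) {p : 𝟭 C ⟶ 𝟭 C}
    (hp1 : p.app (s o) = 𝟙 (s o)) (hp2 : ∀ j, j ≠ o → p.app (s j) = 0) (i : I) :
    (∀ j, j ≠ i → loop (s i) (s j) (p.app (dual (s i) ⊗ s j)) = 0) ∧
    h1.coeff (leftDim (s i)) • loop (s i) (s i) (p.app (dual (s i) ⊗ s i)) = 𝟙 (s i) := by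
  have hp : ∀ V, ∃ (n : ℕ) (x : Fin n → (V ⟶ 𝟙_ C)) (y : Fin n → (𝟙_ C ⟶ V)),
      p.app V = ∑ a, x a ≫ y a := by
    intro V
    obtain ⟨n, x, y, h⟩ := hs.exists_isotypic_eq_sum hp1 hp2 V
    exact ⟨n, fun a => x a ≫ e.inv, fun a => e.hom ≫ y a, by simpa using h⟩
  have hfix : ∀ {V} (y : 𝟙_ C ⟶ V), y ≫ p.app V = y := by
    intro V y
    have h3 : (e.inv ≫ y) ≫ p.app V = e.inv ≫ y :=
      (p.naturality (e.inv ≫ y)).trans (by rw [hp1]; exact Category.id_comp _)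
    rw [Category.assoc] at h3
    exact (cancel_epi e.inv).1 h3
  constructor
  · intro j hj
    obtain ⟨n, x, y, h⟩ := hp (dual (s i) ⊗ s j)
    -- `Hom(𝟙, (s i)* ⊗ s j) ≅ Hom(s i, s j) = 0`, so `(s i)* ⊗ s j` has no unit component.
    have hy : ∀ a, y a = 0 := by
      intro a
      apply eq_of_rev
      have := hs.hom_eq_zero i j hj.symm ((ρ_ _).inv ≫ s i ◁ y a ≫ (α_ _ _ _).inv ≫
        rev (s i) ▷ s j ≫ (λ_ _).hom)
      rw [← cancel_epi (ρ_ (s i)).inv, ← cancel_mono (λ_ (s j)).hom]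
      simpa using this
    have : p.app (dual (s i) ⊗ s j) = 0 := by rw [h]; simp [hy]
    rw [this, loop]
    simp [monoidalComp]
  · obtain ⟨n, x, y, h⟩ := hp (dual (s i) ⊗ s i)
    have hy : ∀ a, ∃ c : k, y a = c • rcoev (s i) := by
      intro a
      obtain ⟨c, hc⟩ := (hs.scalar i).exists_smul ((ρ_ _).inv ≫ s i ◁ y a ≫ (α_ _ _ _).inv ≫
        rev (s i) ▷ s i ≫ (λ_ _).hom)
      refine ⟨c, eq_of_rev ?_⟩
      rw [← cancel_epi (ρ_ (s i)).inv, ← cancel_mono (λ_ (s i)).hom]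
      have hz : (ρ_ _).inv ≫ s i ◁ rcoev (s i) ≫ (α_ _ _ _).inv ≫ rev (s i) ▷ s i ≫ (λ_ _).hom =
          𝟙 (s i) := by
        calc
          _ = 𝟙 _ ⊗≫ (s i ◁ rcoev (s i) ⊗≫ rev (s i) ▷ s i) ⊗≫ 𝟙 _ := by monoidal
          _ = _ := by rw [rcoev_rev]; monoidal
      simpa [hz] using hc
    have hx : ∀ a, ∃ c : k, x a = c • lev (s i) := by
      intro a
      obtain ⟨c, hc⟩ := (hs.scalar i).exists_smul ((λ_ _).inv ≫ lcoev (s i) ▷ s i ≫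
        (α_ _ _ _).hom ≫ s i ◁ x a ≫ (ρ_ _).hom)
      refine ⟨c, eq_of_lcoev ?_⟩
      rw [← cancel_epi (λ_ (s i)).inv, ← cancel_mono (ρ_ (s i)).hom]
      have hz : (λ_ _).inv ≫ lcoev (s i) ▷ s i ≫ (α_ _ _ _).hom ≫ s i ◁ lev (s i) ≫ (ρ_ _).hom =
          𝟙 (s i) := by
        calc
          _ = 𝟙 _ ⊗≫ (lcoev (s i) ▷ s i ⊗≫ s i ◁ lev (s i)) ⊗≫ 𝟙 _ := by monoidal
          _ = _ := by rw [lcoev_lev']; monoidal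
      simpa [hz] using hc
    choose cy hcy using hy
    choose cx hcx using hx
    -- The morphisms between `𝟙` and `(s i)* ⊗ s i`, in either direction, are multiples of `rcoev`
    -- and `lev`, so `p` is a multiple of `lev ≫ rcoev` there.
    have hpc : p.app (dual (s i) ⊗ s i) = (∑ a, cx a * cy a) • (lev (s i) ≫ rcoev (s i)) := by
      rw [h, Finset.sum_smul]
      refine Finset.sum_congr rfl fun a _ => ?_
      rw [hcx, hcy, Linear.smul_comp, Linear.comp_smul, smul_smul]
    set c := ∑ a, cx a * cy a
    have hd : leftDim (s i) = h1.coeff (leftDim (s i)) • 𝟙 _ := (h1.coeff_smul_id _).symm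
    have hr0 : rcoev (s i) ≠ 0 := by
      intro h0
      have := rcoev_rev (s i)
      rw [h0] at this
      have h2 : 𝟙 (s i) = 0 := by
        calc
          _ = 𝟙 _ ⊗≫ (s i ◁ (0 : 𝟙_ C ⟶ dual (s i) ⊗ s i) ⊗≫ rev (s i) ▷ s i) ⊗≫ 𝟙 _ := by
            rw [this]; monoidal
          _ = 0 := by simp [monoidalComp]
      exact (hs.scalar i).id_ne_zero h2
    -- `p` fixes `rcoev`, while `rcoev ≫ lev = dim_l (s i)`; hence `c` is the inverse of the left
    -- dimension.
    have hcd : h1.coeff (leftDim (s i)) * c = 1 := by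
      have h2 := hfix (rcoev (s i))
      have h3 : rcoev (s i) ≫ lev (s i) = leftDim (s i) := by simp [leftDim, leftTrace]
      rw [hpc, Linear.comp_smul, ← Category.assoc, h3] at h2
      rw [hd] at h2
      simp only [Linear.smul_comp, Category.id_comp, smul_smul] at h2
      by_contra h4
      have h5 : (h1.coeff (leftDim (s i)) * c - 1) • rcoev (s i) = 0 := by
        rw [sub_smul, one_smul, mul_comm, h2, sub_self]
      rcases smul_eq_zero.1 h5 with h | h
      · exact h4 (sub_eq_zero.1 h)
      · exact hr0 h
    have hl : loop (s i) (s i) (p.app (dual (s i) ⊗ s i)) = c • 𝟙 _ := by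
      rw [hpc]
      calc
        _ = c • loop (s i) (s i) (lev (s i) ≫ rcoev (s i)) := by
          simp [loop, monoidalComp]
        _ = c • (𝟙 _ ⊗≫ (lcoev (s i) ▷ s i ⊗≫ s i ◁ lev (s i)) ⊗≫
            (s i ◁ rcoev (s i) ⊗≫ rev (s i) ▷ s i) ⊗≫ 𝟙 _) := by
          rw [loop]; congr 1; monoidal
        _ = _ := by
          rw [lcoev_lev', rcoev_rev]; congr 1; monoidal
    rw [hl, smul_smul, hcd, one_smul]

/-- If the unit of the adjunction splits at the unit object, then the dimension does not vanish. -/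
theorem sum_dim_ne_zero (h1 : IsScalar k (𝟙_ C)) {R : C} {u : ∀ V, R ⊗ V ⟶ V ⊗ 𝟙_ C}
    (hu : IsCofree u) {η : 𝟙_ C ⟶ R} (hη : ∀ V, η ▷ V ≫ u V = (λ_ V).hom ≫ (ρ_ V).inv)
    {r : R ⟶ 𝟙_ C} (hr : ∀ W, r ▷ W ≫ (λ_ W).hom ≫ (ρ_ W).inv = hu.braiding W ≫ W ◁ r)
    (hηr : η ≫ r = 𝟙 _) :
    ∑ i, h1.coeff (rightDim (s i)) * h1.coeff (leftDim (s i)) ≠ 0 := by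
  obtain ⟨o, ⟨e⟩⟩ := hs.exists_iso h1
  choose p hp1 hp2 using hs.exists_isotypic
  have hlift : ∀ φ : 𝟭 C ⟶ 𝟭 C, ∃ a : 𝟙_ C ⟶ R, ∀ V, a ▷ V ≫ u V =
      (λ_ V).hom ≫ φ.app V ≫ (ρ_ V).inv := fun φ =>
    hu.exists_lift' (fun V => (λ_ V).hom ≫ φ.app V ≫ (ρ_ V).inv) fun {V V'} f => by
      have : f ≫ φ.app V' = φ.app V ≫ f := φ.naturality f
      simp [reassoc_of% this]
  choose a ha using fun i => hlift (p i)
  obtain ⟨c, hc⟩ := h1.exists_smul (a o ≫ r)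
  have key : ∀ i, a i ≫ r =
      (c * (h1.coeff (rightDim (s i)) * h1.coeff (leftDim (s i)))) • 𝟙 _ := by
    intro i
    obtain ⟨b, hb, hbr⟩ := hu.exists_loop_lift (k := k) (φ := fun V => (p o).app V) (ha o) hr hc (s i)
    obtain ⟨hl0, hl1⟩ := hs.leftDim_smul_loop h1 e (hp1 o) (hp2 o) i
    -- The rescaled loop is natural and agrees with `p i` on all simple objects, so `a i` is `dim_l
    -- (s i)` times the encircled `a o`.
    let q : 𝟭 C ⟶ 𝟭 C :=
      { app := fun V => h1.coeff (leftDim (s i)) • loop (s i) V ((p o).app (dual (s i) ⊗ V))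
        naturality := fun V V' f => by
          have := loop_naturality (s i) f ((p o).naturality (dual (s i) ◁ f))
          simp only [Functor.id_map, Linear.comp_smul, Linear.smul_comp]
          rw [← this] }
    have hq : q = p i := hs.natTrans_ext fun j => by
      obtain rfl | hj := eq_or_ne j i
      · exact hl1.trans (hp1 j).symm
      · rw [hp2 i j hj]
        change _ • _ = _
        rw [hl0 j hj, smul_zero]
    have hab : a i = h1.coeff (leftDim (s i)) • b := hu.hom_ext' _ _ fun V => by
      rw [MonoidalLinear.smul_whiskerRight, Linear.smul_comp, hb, ha, ← hq]
      simp [q]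
    rw [hab, Linear.smul_comp, hbr, ← h1.coeff_smul_id (rightDim (s i)), smul_smul, smul_smul]
    congr 1
    rw [h1.coeff_smul_id]
    ring
  -- `η` corresponds to the identity transformation, the sum of the isotypic projections.
  have hsum : ∑ i, a i = η := hu.hom_ext' _ _ fun V => by
    have hid : ∑ i, p i = 𝟙 (𝟭 C) := hs.natTrans_ext fun j => by
      classical
      rw [NatTrans.app_sum, Finset.sum_eq_single j]
      · exact hp1 j
      · intro i _ hi
        exact hp2 i j hi.symm
      · simp
    have hV : ∑ i, (p i).app V = 𝟙 V := by
      rw [← NatTrans.app_sum, hid]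
      rfl
    rw [sum_whiskerRight, Preadditive.sum_comp, hη]
    simp only [ha]
    rw [← Preadditive.comp_sum, ← Preadditive.sum_comp]
    exact congrArg (fun t => (λ_ V).hom ≫ t) ((congrArg (fun t => t ≫ (ρ_ V).inv) hV).trans
      (Category.id_comp _))
  intro h0
  have : 𝟙 (𝟙_ C) = 0 := by
    rw [← hηr, ← hsum, Preadditive.sum_comp]
    simp only [key, ← Finset.sum_smul, ← Finset.mul_sum, h0]
    simp
  exact h1.id_ne_zero this

end IsSimpleSystem

end Cofree
end FusionCenter

namespace FusionCenter

/-! ### Bending strands and partial traces -/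

section Bend

open PivotalCategory

variable {C : Type u} [Category.{v} C] [MonoidalCategory C] [PivotalCategory C]

/-- The partial right trace. -/
def partialTrace {Y A : C} (V : C) (f : Y ⊗ V ⟶ A ⊗ V) : Y ⟶ A :=
  𝟙 _ ⊗≫ Y ◁ lcoev V ⊗≫ f ▷ dual V ⊗≫ A ◁ rev V ⊗≫ 𝟙 _

/-- A morphism `W ⊗ U ⟶ V`, bent to a morphism `V* ⊗ W ⟶ U*`. -/
def bendIn {U V W : C} (f : W ⊗ U ⟶ V) : dual V ⊗ W ⟶ dual U :=
  𝟙 _ ⊗≫ (dual V ⊗ W) ◁ lcoev U ⊗≫ dual V ◁ f ▷ dual U ⊗≫ lev V ▷ dual U ⊗≫ 𝟙 _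

/-- A morphism `V ⟶ W ⊗ U`, bent to a morphism `U* ⟶ V* ⊗ W`. -/
def bendOut {U V W : C} (h : V ⟶ W ⊗ U) : dual U ⟶ dual V ⊗ W :=
  𝟙 _ ⊗≫ rcoev V ▷ dual U ⊗≫ dual V ◁ h ▷ dual U ⊗≫ (dual V ⊗ W) ◁ rev U ⊗≫ 𝟙 _

variable {U V W : C}

theorem bendIn_lev (f : W ⊗ U ⟶ V) :
    bendIn f ▷ U ≫ lev U = (α_ _ _ _).hom ≫ dual V ◁ f ≫ lev V := by
  calc
    _ = 𝟙 _ ⊗≫ (dual V ⊗ W) ◁ lcoev U ▷ U ⊗≫ dual V ◁ f ▷ (dual U ⊗ U) ⊗≫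
        (lev V ▷ (dual U ⊗ U) ≫ 𝟙_ C ◁ lev U) ⊗≫ 𝟙 _ := by
      rw [bendIn]; monoidal
    _ = 𝟙 _ ⊗≫ (dual V ⊗ W) ◁ lcoev U ▷ U ⊗≫ dual V ◁ (f ▷ (dual U ⊗ U) ≫ V ◁ lev U) ⊗≫
        lev V ⊗≫ 𝟙 _ := by
      rw [← whisker_exchange]; monoidal
    _ = 𝟙 _ ⊗≫ (dual V ⊗ W) ◁ (lcoev U ▷ U ⊗≫ U ◁ lev U) ⊗≫ dual V ◁ f ⊗≫ lev V ⊗≫ 𝟙 _ := by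
      rw [← whisker_exchange]; monoidal
    _ = _ := by
      rw [lcoev_lev']; monoidal

theorem rcoev_bendOut (h : V ⟶ W ⊗ U) :
    rcoev U ≫ bendOut h ▷ U = rcoev V ≫ dual V ◁ h ≫ (α_ _ _ _).inv := by
  calc
    _ = 𝟙 _ ⊗≫ (𝟙_ C ◁ rcoev U ≫ rcoev V ▷ (dual U ⊗ U)) ⊗≫ dual V ◁ h ▷ dual U ▷ U ⊗≫
        (dual V ⊗ W) ◁ rev U ▷ U ⊗≫ 𝟙 _ := by
      rw [bendOut]; monoidal
    _ = 𝟙 _ ⊗≫ rcoev V ⊗≫ dual V ◁ (V ◁ rcoev U ≫ h ▷ (dual U ⊗ U)) ⊗≫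
        (dual V ⊗ W) ◁ rev U ▷ U ⊗≫ 𝟙 _ := by
      rw [whisker_exchange]; monoidal
    _ = 𝟙 _ ⊗≫ rcoev V ⊗≫ dual V ◁ h ⊗≫ (dual V ⊗ W) ◁ (U ◁ rcoev U ⊗≫ rev U ▷ U) ⊗≫ 𝟙 _ := by
      rw [whisker_exchange]; monoidal
    _ = _ := by
      rw [rcoev_rev]; monoidal

/-- Compares the composition pairing before and after bending; the left dimensions in the averaging
weights originate here. -/
theorem leftTrace_bendOut_bendIn (h : V ⟶ W ⊗ U) (f : W ⊗ U ⟶ V) :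
    rcoev U ≫ (bendOut h ≫ bendIn f) ▷ U ≫ lev U = leftTrace (h ≫ f) := by
  rw [comp_whiskerRight, Category.assoc, bendIn_lev, ← Category.assoc, rcoev_bendOut, leftTrace]
  simp

theorem exists_bendOut_eq (g : dual U ⟶ dual V ⊗ W) : ∃ h : V ⟶ W ⊗ U, bendOut h = g := by
  refine ⟨𝟙 _ ⊗≫ V ◁ rcoev U ⊗≫ V ◁ g ▷ U ⊗≫ rev V ▷ (W ⊗ U) ⊗≫ 𝟙 _, ?_⟩
  calc
    _ = 𝟙 _ ⊗≫ rcoev V ▷ dual U ⊗≫ (dual V ⊗ V) ◁ (rcoev U ▷ dual U) ⊗≫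
        (dual V ⊗ V) ◁ g ▷ (U ⊗ dual U) ⊗≫
        dual V ◁ (rev V ▷ (W ⊗ (U ⊗ dual U)) ≫ 𝟙_ C ◁ (W ◁ rev U)) ⊗≫ 𝟙 _ := by
      rw [bendOut]; monoidal
    _ = 𝟙 _ ⊗≫ rcoev V ▷ dual U ⊗≫ (dual V ⊗ V) ◁ (rcoev U ▷ dual U) ⊗≫
        (dual V ⊗ V) ◁ (g ▷ (U ⊗ dual U) ≫ (dual V ⊗ W) ◁ rev U) ⊗≫
        dual V ◁ rev V ▷ W ⊗≫ 𝟙 _ := by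
      rw [← whisker_exchange]; monoidal
    _ = 𝟙 _ ⊗≫ rcoev V ▷ dual U ⊗≫ (dual V ⊗ V) ◁ (rcoev U ▷ dual U ⊗≫ dual U ◁ rev U) ⊗≫
        (dual V ⊗ V) ◁ g ⊗≫ dual V ◁ rev V ▷ W ⊗≫ 𝟙 _ := by
      rw [← whisker_exchange]; monoidal
    _ = 𝟙 _ ⊗≫ (rcoev V ▷ dual U ≫ (dual V ⊗ V) ◁ g) ⊗≫ dual V ◁ rev V ▷ W ⊗≫ 𝟙 _ := by
      rw [rcoev_rev']; monoidal
    _ = 𝟙 _ ⊗≫ g ⊗≫ (rcoev V ▷ dual V ⊗≫ dual V ◁ rev V) ▷ W ⊗≫ 𝟙 _ := by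
      rw [← whisker_exchange]; monoidal
    _ = _ := by
      rw [rcoev_rev']; monoidal

theorem lcoev_bendIn (f : W ⊗ U ⟶ V) :
    lcoev V ▷ W ⊗≫ V ◁ bendIn f = 𝟙 _ ⊗≫ W ◁ lcoev U ⊗≫ f ▷ dual U ⊗≫ 𝟙 _ := by
  calc
    _ = 𝟙 _ ⊗≫ (lcoev V ▷ (W ⊗ 𝟙_ C) ≫ (V ⊗ dual V) ◁ (W ◁ lcoev U)) ⊗≫
        (V ⊗ dual V) ◁ f ▷ dual U ⊗≫ V ◁ lev V ▷ dual U ⊗≫ 𝟙 _ := by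
      rw [bendIn]; monoidal
    _ = 𝟙 _ ⊗≫ W ◁ lcoev U ⊗≫ (lcoev V ▷ (W ⊗ U) ≫ (V ⊗ dual V) ◁ f) ▷ dual U ⊗≫
        V ◁ lev V ▷ dual U ⊗≫ 𝟙 _ := by
      rw [← whisker_exchange]; monoidal
    _ = 𝟙 _ ⊗≫ W ◁ lcoev U ⊗≫ f ▷ dual U ⊗≫ (lcoev V ▷ V ⊗≫ V ◁ lev V) ▷ dual U ⊗≫ 𝟙 _ := by
      rw [← whisker_exchange]; monoidal
    _ = _ := by
      rw [lcoev_lev']; monoidal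

theorem bendOut_rev (h : V ⟶ W ⊗ U) :
    V ◁ bendOut h ⊗≫ rev V ▷ W = 𝟙 _ ⊗≫ h ▷ dual U ⊗≫ W ◁ rev U ⊗≫ 𝟙 _ := by
  calc
    _ = 𝟙 _ ⊗≫ V ◁ rcoev V ▷ dual U ⊗≫ (V ⊗ dual V) ◁ h ▷ dual U ⊗≫
        ((V ⊗ dual V) ◁ (W ◁ rev U) ≫ rev V ▷ (W ⊗ 𝟙_ C)) ⊗≫ 𝟙 _ := by
      rw [bendOut]; monoidal
    _ = 𝟙 _ ⊗≫ V ◁ rcoev V ▷ dual U ⊗≫ ((V ⊗ dual V) ◁ h ≫ rev V ▷ (W ⊗ U)) ▷ dual U ⊗≫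
        W ◁ rev U ⊗≫ 𝟙 _ := by
      rw [whisker_exchange]; monoidal
    _ = 𝟙 _ ⊗≫ (V ◁ rcoev V ⊗≫ rev V ▷ V) ▷ dual U ⊗≫ h ▷ dual U ⊗≫ W ◁ rev U ⊗≫ 𝟙 _ := by
      rw [whisker_exchange]; monoidal
    _ = _ := by
      rw [rcoev_rev]; monoidal

/-- Moves `f` and `h` from the traced strand `U` onto the dual strand: the loop now runs along `V`,
so that sums over `U` can be carried out inside it. -/
theorem partialTrace_conj {Y A : C} (ψ : Y ⊗ V ⟶ A ⊗ V) (f : W ⊗ U ⟶ V) (h : V ⟶ W ⊗ U) :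
    partialTrace U ((α_ _ _ _).hom ≫ (Y ◁ f ≫ ψ ≫ A ◁ h) ≫ (α_ _ _ _).inv) =
      𝟙 _ ⊗≫ Y ◁ lcoev V ▷ W ⊗≫ ψ ▷ (dual V ⊗ W) ⊗≫ (A ⊗ V) ◁ (bendIn f ≫ bendOut h) ⊗≫
        A ◁ rev V ▷ W ⊗≫ 𝟙 _ := by
  symm
  calc
    _ = 𝟙 _ ⊗≫ Y ◁ lcoev V ▷ W ⊗≫ (ψ ▷ (dual V ⊗ W) ≫ (A ⊗ V) ◁ bendIn f) ⊗≫
        A ◁ (V ◁ bendOut h ⊗≫ rev V ▷ W) ⊗≫ 𝟙 _ := by monoidal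
    _ = 𝟙 _ ⊗≫ Y ◁ (lcoev V ▷ W ⊗≫ V ◁ bendIn f) ⊗≫ ψ ▷ dual U ⊗≫
        A ◁ (V ◁ bendOut h ⊗≫ rev V ▷ W) ⊗≫ 𝟙 _ := by
      rw [← whisker_exchange]; monoidal
    _ = _ := by
      rw [lcoev_bendIn, bendOut_rev, partialTrace]; monoidal

/-- A morphism `x : U ⟶ X*`, bent to a morphism `X ⟶ U*`, and a morphism `y : X* ⟶ U`, bent to a
morphism `U* ⟶ X`. -/
theorem exists_bend_dual {X : C} (y : dual X ⟶ U) (x : U ⟶ dual X) :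
    ∃ (x' : X ⟶ dual U) (y' : dual U ⟶ X),
      x' ≫ y' = 𝟙 _ ⊗≫ lcoev X ▷ X ⊗≫ X ◁ (y ≫ x) ▷ X ⊗≫ X ◁ lev X ⊗≫ 𝟙 _ := by
  refine ⟨𝟙 _ ⊗≫ rcoev U ▷ X ⊗≫ dual U ◁ x ▷ X ⊗≫ dual U ◁ lev X ⊗≫ 𝟙 _,
    𝟙 _ ⊗≫ lcoev X ▷ dual U ⊗≫ X ◁ y ▷ dual U ⊗≫ X ◁ rev U ⊗≫ 𝟙 _, ?_⟩
  let z : X ⟶ dual U := 𝟙 _ ⊗≫ rcoev U ▷ X ⊗≫ dual U ◁ x ▷ X ⊗≫ dual U ◁ lev X ⊗≫ 𝟙 _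
  have hz : U ◁ z ⊗≫ rev U ▷ 𝟙_ C = 𝟙 _ ⊗≫ x ▷ X ⊗≫ lev X ⊗≫ 𝟙 _ := by
    calc
      _ = 𝟙 _ ⊗≫ U ◁ rcoev U ▷ X ⊗≫ ((U ⊗ dual U) ◁ (x ▷ X ≫ lev X) ≫ rev U ▷ 𝟙_ C) ⊗≫ 𝟙 _ := by
        dsimp only [z]; monoidal
      _ = 𝟙 _ ⊗≫ (U ◁ rcoev U ⊗≫ rev U ▷ U) ▷ X ⊗≫ x ▷ X ⊗≫ lev X ⊗≫ 𝟙 _ := by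
        rw [whisker_exchange]; monoidal
      _ = _ := by rw [rcoev_rev]; monoidal
  change z ≫ _ = _
  calc
    _ = 𝟙 _ ⊗≫ (𝟙_ C ◁ z ≫ lcoev X ▷ dual U) ⊗≫ X ◁ y ▷ dual U ⊗≫ X ◁ rev U ⊗≫ 𝟙 _ := by monoidal
    _ = 𝟙 _ ⊗≫ lcoev X ▷ X ⊗≫ X ◁ (dual X ◁ z ≫ y ▷ dual U) ⊗≫ X ◁ rev U ⊗≫ 𝟙 _ := by
      rw [whisker_exchange]; monoidal
    _ = 𝟙 _ ⊗≫ lcoev X ▷ X ⊗≫ X ◁ y ▷ X ⊗≫ X ◁ (U ◁ z ⊗≫ rev U ▷ 𝟙_ C) ⊗≫ 𝟙 _ := by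
      rw [whisker_exchange]; monoidal
    _ = _ := by rw [hz]; monoidal

end Bend
end FusionCenter

namespace FusionCenter

/-! ### Averaging: a nonzero dimension makes the center regular -/

section Average

open PivotalCategory

variable {C : Type u} [Category.{v} C] [MonoidalCategory C] [PivotalCategory C]
  {k : Type w} [Field k] [Preadditive C] [Linear k C] [MonoidalPreadditive C] [MonoidalLinear k C]

theorem bendOut_smul {U V W : C} (c : k) (h : V ⟶ W ⊗ U) :
    bendOut (c • h) = c • bendOut h := by
  simp [bendOut, monoidalComp]

theorem bendOut_sum {U V W : C} {J : Type*} (S : Finset J) (h : J → (V ⟶ W ⊗ U)) :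
    bendOut (∑ a ∈ S, h a) = ∑ a ∈ S, bendOut (h a) := by
  simp only [bendOut, monoidalComp, whiskerLeft_sum, sum_whiskerRight, Preadditive.sum_comp,
    Preadditive.comp_sum]

theorem partialTrace_sum {Y A V : C} {J : Type*} (S : Finset J) (f : J → (Y ⊗ V ⟶ A ⊗ V)) :
    partialTrace V (∑ a ∈ S, f a) = ∑ a ∈ S, partialTrace V (f a) := by
  simp only [partialTrace, monoidalComp, sum_whiskerRight, Preadditive.sum_comp,
    Preadditive.comp_sum]

namespace IsSimpleSystem

variable {I : Type*} [Fintype I] {s : I → C} (hs : IsSimpleSystem k s)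
include hs

/-- Every endomorphism of `(s i)*` is bent from an endomorphism of `s i`, by `exists_bendOut_eq`
with `W` the unit. -/
theorem dual_hom_smul (i : I) (f : dual (s i) ⟶ dual (s i)) : ∃ z : k, f = z • 𝟙 _ := by
  obtain ⟨h, hh⟩ := exists_bendOut_eq (f ≫ (ρ_ _).inv)
  obtain ⟨c, hc⟩ := (hs.scalar i).exists_smul (h ≫ (λ_ _).hom)
  have hc' : h = c • (λ_ _).inv := by
    rw [← cancel_mono (λ_ (s i)).hom, hc]
    simp
  have h1 : bendOut (λ_ (s i)).inv ≫ (ρ_ _).hom = 𝟙 _ := by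
    calc
      _ = 𝟙 _ ⊗≫ (rcoev (s i) ▷ dual (s i) ⊗≫ dual (s i) ◁ rev (s i)) ⊗≫ 𝟙 _ := by
        rw [bendOut]; monoidal
      _ = _ := by rw [rcoev_rev']; monoidal
  refine ⟨c, ?_⟩
  rw [← cancel_mono (ρ_ _).inv, ← hh, hc', bendOut_smul, Linear.smul_comp, ← h1]
  simp

omit [MonoidalLinear k C] in
theorem dual_hom_eq_zero {i j : I} (hij : i ≠ j) (f : dual (s i) ⟶ dual (s j)) : f = 0 := by
  obtain ⟨h, hh⟩ := exists_bendOut_eq (f ≫ (ρ_ _).inv)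
  have h0 : h ≫ (λ_ _).hom = 0 := hs.hom_eq_zero j i hij.symm _
  have h0' : h = 0 := by
    rw [← cancel_mono (λ_ (s i)).hom, h0, zero_comp]
  rw [← cancel_mono (ρ_ _).inv, ← hh, h0']
  simp [bendOut, monoidalComp]

omit [MonoidalLinear k C] in
-- The duals of the `s i` also detect equality: decompose `dual X` into simple objects and bend the
-- decomposition back to `X`.
theorem dual_hom_ext {X Z : C} {f g : X ⟶ Z} (h : ∀ i (x : dual (s i) ⟶ X), x ≫ f = x ≫ g) :
    f = g := by
  obtain ⟨n, π, ι, hX⟩ := hs.complete (dual X)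
  choose x' y' hxy using fun i a => exists_bend_dual (π i a) (ι i a)
  have hid : ∑ i, ∑ a, x' i a ≫ y' i a = 𝟙 X := by
    calc
      _ = 𝟙 _ ⊗≫ lcoev X ▷ X ⊗≫ X ◁ (∑ i, ∑ a, π i a ≫ ι i a) ▷ X ⊗≫ X ◁ lev X ⊗≫ 𝟙 _ := by
        simp only [hxy, monoidalComp, whiskerLeft_sum, sum_whiskerRight, Preadditive.sum_comp,
          Preadditive.comp_sum]
      _ = 𝟙 _ ⊗≫ (lcoev X ▷ X ⊗≫ X ◁ lev X) ⊗≫ 𝟙 _ := by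
        rw [hX]; monoidal
      _ = _ := by rw [lcoev_lev']; monoidal
  rw [← Category.id_comp f, ← Category.id_comp g, ← hid]
  simp only [Preadditive.sum_comp, Category.assoc, h]

variable (h1 : IsScalar k (𝟙_ C))

/-- The composite is a scalar `z`, and left traces give `z dim_l (s i) = c dim_l (s j)`. In this
form no dimension has to be inverted. -/
theorem leftDim_smul_bendOut_bendIn {i j : I} {W : C} (h : s j ⟶ W ⊗ s i) (f : W ⊗ s i ⟶ s j)
    {c : k} (hc : h ≫ f = c • 𝟙 _) : h1.coeff (leftDim (s i)) • (bendOut h ≫ bendIn f) =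
      (c * h1.coeff (leftDim (s j))) • 𝟙 _ := by
  obtain ⟨z, hz⟩ := hs.dual_hom_smul i (bendOut h ≫ bendIn f)
  have h2 := leftTrace_bendOut_bendIn h f
  have h3 : leftTrace (c • 𝟙 (s j)) = c • leftDim (s j) := by
    simp [leftDim, leftTrace]
  have h4 : rcoev (s i) ≫ (z • 𝟙 (dual (s i))) ▷ s i ≫ lev (s i) = z • leftDim (s i) := by
    simp [leftDim, leftTrace]
  rw [hz, hc, h3, h4, ← h1.coeff_smul_id (leftDim (s i)), ← h1.coeff_smul_id (leftDim (s j)),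
    smul_smul, smul_smul] at h2
  rw [hz, smul_smul, mul_comm, h1.smul_id_injective h2]

/-- Bending a decomposition of all the `W ⊗ s i` yields, up to ratios of left dimensions, a
decomposition of `(s j)* ⊗ W` into duals of simple objects. It is tested on maps from `(s i)*`, all
of the form `bendOut h`. -/
theorem sum_bendIn_bendOut (j : I) (W : C) {n : I → I → ℕ}
    (π : ∀ i j, Fin (n i j) → (W ⊗ s i ⟶ s j)) (ι : ∀ i j, Fin (n i j) → (s j ⟶ W ⊗ s i))
    (hW : ∀ i, ∑ j, ∑ a, π i j a ≫ ι i j a = 𝟙 (W ⊗ s i)) :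
    ∑ i, ∑ a, h1.coeff (leftDim (s i)) • (bendIn (π i j a) ≫ bendOut (ι i j a)) =
      h1.coeff (leftDim (s j)) • 𝟙 (dual (s j) ⊗ W) := by
  classical
  refine hs.dual_hom_ext fun i g => ?_
  obtain ⟨h, rfl⟩ := exists_bendOut_eq g
  have hsum : ∑ a, (h ≫ π i j a) ≫ ι i j a = h := by
    calc
      _ = h ≫ ∑ l, ∑ a, π i l a ≫ ι i l a := by
        rw [Preadditive.comp_sum, Finset.sum_eq_single j]
        · simp [Preadditive.comp_sum]
        · intro l _ hl
          simp only [Preadditive.comp_sum]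
          refine Finset.sum_eq_zero fun a _ => ?_
          rw [← Category.assoc, hs.hom_eq_zero j l hl.symm (h ≫ π i l a), zero_comp]
        · simp
      _ = h := by rw [hW, Category.comp_id]
  choose c hc using fun a => (hs.scalar j).exists_smul (h ≫ π i j a)
  rw [Preadditive.comp_sum, Finset.sum_eq_single i]
  · simp only [Preadditive.comp_sum, Linear.comp_smul, Category.comp_id]
    calc
      _ = ∑ a, (h1.coeff (leftDim (s i)) • (bendOut h ≫ bendIn (π i j a))) ≫ bendOut (ι i j a) := by
        simp
      _ = h1.coeff (leftDim (s j)) • bendOut (∑ a, c a • ι i j a) := by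
        rw [bendOut_sum, Finset.smul_sum]
        refine Finset.sum_congr rfl fun a _ => ?_
        rw [hs.leftDim_smul_bendOut_bendIn h1 _ _ (hc a), bendOut_smul, smul_smul,
          Linear.smul_comp, Category.id_comp, mul_comm]
      _ = _ := by
        congr 2
        conv_rhs => rw [← hsum]
        simp [hc]
  · intro l _ hl
    simp only [Preadditive.comp_sum, Linear.comp_smul]
    refine Finset.sum_eq_zero fun a _ => ?_
    rw [← Category.assoc, hs.dual_hom_eq_zero hl.symm (bendOut h ≫ bendIn (π l j a)), zero_comp,
      smul_zero]
  · simp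

/-- Handle slide: decompose `W ⊗ s i` into the `s j`, exchange the sums, and apply
`sum_bendIn_bendOut` on the loop of each `s j`; the strand `W` passes through freely. -/
theorem sum_partialTrace_tensor {Y A : C} (ψ : ∀ V, Y ⊗ V ⟶ A ⊗ V)
    (hψ : ∀ {V V'} (f : V ⟶ V'), Y ◁ f ≫ ψ V' = ψ V ≫ A ◁ f) (W : C) :
    ∑ i, h1.coeff (leftDim (s i)) •
      partialTrace (s i) ((α_ _ _ _).hom ≫ ψ (W ⊗ s i) ≫ (α_ _ _ _).inv) =
    (∑ i, h1.coeff (leftDim (s i)) • partialTrace (s i) (ψ (s i))) ▷ W := by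
  choose n π ι hW using fun i => hs.complete (W ⊗ s i)
  have hψW : ∀ i, ψ (W ⊗ s i) = ∑ j, ∑ a, Y ◁ π i j a ≫ ψ (s j) ≫ A ◁ ι i j a := by
    intro i
    calc
      _ = ψ (W ⊗ s i) ≫ A ◁ ∑ j, ∑ a, π i j a ≫ ι i j a := by rw [hW]; simp
      _ = _ := by
        simp only [whiskerLeft_sum, Preadditive.comp_sum]
        refine Finset.sum_congr rfl fun j _ => Finset.sum_congr rfl fun a _ => ?_
        rw [← hψ, MonoidalCategory.whiskerLeft_comp, Category.assoc, ← hψ]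
  let G : ∀ j, (dual (s j) ⊗ W ⟶ dual (s j) ⊗ W) → (Y ⊗ W ⟶ A ⊗ W) := fun j e =>
    𝟙 _ ⊗≫ Y ◁ lcoev (s j) ▷ W ⊗≫ ψ (s j) ▷ (dual (s j) ⊗ W) ⊗≫ (A ⊗ s j) ◁ e ⊗≫
        A ◁ rev (s j) ▷ W ⊗≫ 𝟙 _
  have hGs : ∀ j {J : Type} (S : Finset J)
      (e : J → (dual (s j) ⊗ W ⟶ dual (s j) ⊗ W)), G j (∑ a ∈ S, e a) = ∑ a ∈ S, G j (e a) := by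
    intro j J S e
    simp only [G, monoidalComp, whiskerLeft_sum, Preadditive.sum_comp, Preadditive.comp_sum]
  have hGs' : ∀ j (e : I → (dual (s j) ⊗ W ⟶ dual (s j) ⊗ W)), G j (∑ a, e a) = ∑ a, G j (e a) := by
    intro j e
    simp only [G, monoidalComp, whiskerLeft_sum, Preadditive.sum_comp, Preadditive.comp_sum]
  have hGm : ∀ j (c : k) e, G j (c • e) = c • G j e := by
    intro j c e
    simp [G, monoidalComp]
  calc
    _ = ∑ i, ∑ j, ∑ a, h1.coeff (leftDim (s i)) •
        G j (bendIn (π i j a) ≫ bendOut (ι i j a)) := by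
      refine Finset.sum_congr rfl fun i _ => ?_
      rw [hψW]
      simp only [Preadditive.sum_comp, Preadditive.comp_sum, partialTrace_sum, Finset.smul_sum]
      refine Finset.sum_congr rfl fun j _ => Finset.sum_congr rfl fun a _ => ?_
      rw [partialTrace_conj]
    _ = ∑ j, G j (∑ i, ∑ a, h1.coeff (leftDim (s i)) •
        (bendIn (π i j a) ≫ bendOut (ι i j a))) := by
      rw [Finset.sum_comm]
      simp only [hGs', hGs, hGm]
    _ = _ := by
      rw [sum_whiskerRight]
      refine Finset.sum_congr rfl fun j _ => ?_
      rw [hs.sum_bendIn_bendOut h1 j W π ι hW, hGm, MonoidalLinear.smul_whiskerRight]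
      congr 1
      dsimp only [G]
      rw [partialTrace]
      monoidal

/-- Averaging a morphism of `C` between objects of the center gives a morphism of the center. -/
theorem exists_average (h1 : IsScalar k (𝟙_ C)) {A B : Center C} (g : B.1 ⟶ A.1) :
    ∃ g' : B ⟶ A, g'.f = ∑ i, h1.coeff (leftDim (s i)) • partialTrace (s i)
      ((B.2.β (s i)).hom ≫ s i ◁ g ≫ (A.2.β (s i)).inv) := by
  suffices comm : ∀ U, (∑ i, h1.coeff (leftDim (s i)) • partialTrace (s i)
      ((B.2.β (s i)).hom ≫ s i ◁ g ≫ (A.2.β (s i)).inv)) ▷ U ≫ (A.2.β U).hom =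
        (B.2.β U).hom ≫ U ◁ ∑ i, h1.coeff (leftDim (s i)) • partialTrace (s i)
          ((B.2.β (s i)).hom ≫ s i ◁ g ≫ (A.2.β (s i)).inv) from ⟨⟨_, comm⟩, rfl⟩
  intro U
  let ψ : ∀ V, B.1 ⊗ V ⟶ A.1 ⊗ V := fun V => (B.2.β V).hom ≫ V ◁ g ≫ (A.2.β V).inv
  have hψ : ∀ {V V'} (f : V ⟶ V'), B.1 ◁ f ≫ ψ V' = ψ V ≫ A.1 ◁ f := by
    intro V V' f
    have h : f ▷ A.1 ≫ (A.2.β V').inv = (A.2.β V).inv ≫ A.1 ◁ f := by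
      rw [Iso.comp_inv_eq, Category.assoc, A.2.naturality, Iso.inv_hom_id_assoc]
    simp only [ψ, Category.assoc]
    rw [← h, whisker_exchange_assoc, HalfBraiding.naturality_assoc]
  -- The loops `s i` beside `U` become loops over the second factor of `U ⊗ s i`. Multiplicativity
  -- of the half braidings then brings that of `B` at `U` to the front and cancels that of `A`
  -- against its inverse.
  have hsum := hs.sum_partialTrace_tensor h1 ψ hψ U
  simp only [ψ] at hsum
  rw [← hsum, whiskerLeft_sum, Preadditive.sum_comp,
    Preadditive.comp_sum]
  refine Finset.sum_congr rfl fun i _ => ?_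
  rw [Linear.smul_comp, MonoidalLinear.whiskerLeft_smul, Linear.comp_smul]
  congr 1
  have h : (A.2.β (U ⊗ s i)).inv = (α_ _ _ _).hom ≫ U ◁ (A.2.β (s i)).inv ≫ (α_ _ _ _).inv ≫
      (A.2.β U).inv ▷ s i ≫ (α_ _ _ _).hom := by
    rw [← cancel_epi (A.2.β (U ⊗ s i)).hom, Iso.hom_inv_id, A.2.monoidal]
    simp
  have h2 : (α_ B.1 U (s i)).hom ≫ ψ (U ⊗ s i) ≫ (α_ A.1 U (s i)).inv =
      (B.2.β U).hom ▷ s i ≫ (α_ _ _ _).hom ≫ U ◁ ψ (s i) ≫ (α_ _ _ _).inv ≫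
        (A.2.β U).inv ▷ s i := by
    simp only [ψ]
    rw [h, B.2.monoidal]
    simp
  calc
    _ = partialTrace (s i) ((B.2.β U).hom ▷ s i ≫ (α_ _ _ _).hom ≫ U ◁ ψ (s i) ≫ (α_ _ _ _).inv ≫
        (A.2.β U).inv ▷ s i) ≫ (A.2.β U).hom := by rw [h2]
    _ = 𝟙 _ ⊗≫ ((B.1 ⊗ U) ◁ lcoev (s i) ≫ (B.2.β U).hom ▷ (s i ⊗ dual (s i))) ⊗≫
        U ◁ ψ (s i) ▷ dual (s i) ⊗≫
        ((A.2.β U).inv ▷ (s i ⊗ dual (s i)) ≫ (A.1 ⊗ U) ◁ rev (s i)) ⊗≫ (A.2.β U).hom := by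
      rw [partialTrace]; monoidal
    _ = (B.2.β U).hom ⊗≫ (U ⊗ B.1) ◁ lcoev (s i) ⊗≫ U ◁ ψ (s i) ▷ dual (s i) ⊗≫
        (U ⊗ A.1) ◁ rev (s i) ⊗≫ ((A.2.β U).inv ≫ (A.2.β U).hom) := by
      rw [whisker_exchange (B.2.β U).hom (lcoev (s i)),
        ← whisker_exchange (A.2.β U).inv (rev (s i))]; monoidal
    _ = _ := by
      rw [Iso.inv_hom_id, partialTrace]; monoidal

/-- Both copies of `f` slide through the half braidings into the loop, where `f ≫ g ≫ f = f`. What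
remains is `f` beside a closed loop `s i`, so the `i`-th term contributes `dim_r (s i) dim_l (s i) •
f`. -/
theorem exists_center_regular (h1 : IsScalar k (𝟙_ C))
    (hd : ∑ i, h1.coeff (rightDim (s i)) * h1.coeff (leftDim (s i)) ≠ 0)
    {A B : Center C} (f : A ⟶ B) : ∃ g : B ⟶ A, f ≫ g ≫ f = f := by
  obtain ⟨g, hg⟩ := hs.exists_regular f.f
  obtain ⟨g', hg'⟩ := hs.exists_average h1 g
  refine ⟨(∑ i, h1.coeff (rightDim (s i)) * h1.coeff (leftDim (s i)))⁻¹ • g', ?_⟩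
  have key : (f ≫ g' ≫ f).f = (∑ i, h1.coeff (rightDim (s i)) * h1.coeff (leftDim (s i))) • f.f := by
    rw [Center.comp_f, Center.comp_f, hg', Preadditive.sum_comp, Preadditive.comp_sum,
      Finset.sum_smul]
    refine Finset.sum_congr rfl fun i _ => ?_
    rw [Linear.smul_comp, Linear.comp_smul, mul_comm, mul_smul]
    congr 1
    have hB : (B.2.β (s i)).hom ≫ (B.2.β (s i)).inv = 𝟙 _ := Iso.hom_inv_id _
    have hA : (A.2.β (s i)).inv ≫ f.f ▷ s i = s i ◁ f.f ≫ (B.2.β (s i)).inv := by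
      rw [Iso.inv_comp_eq, ← Category.assoc, Iso.eq_comp_inv, f.comm]
    have hm : f.f ▷ s i ≫ ((B.2.β (s i)).hom ≫ s i ◁ g ≫ (A.2.β (s i)).inv) ≫ f.f ▷ s i =
        f.f ▷ s i := by
      rw [Category.assoc, Category.assoc, hA, f.comm_assoc, ← MonoidalCategory.whiskerLeft_comp_assoc,
        ← MonoidalCategory.whiskerLeft_comp_assoc, Category.assoc, hg, ← f.comm_assoc, hB,
        Category.comp_id]
    generalize ((B.2.β (s i)).hom ≫ s i ◁ g ≫ (A.2.β (s i)).inv) = t at hm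
    calc
      _ = 𝟙 _ ⊗≫ (f.f ▷ 𝟙_ C ≫ B.1 ◁ lcoev (s i)) ⊗≫ t ▷ dual (s i) ⊗≫
          (A.1 ◁ rev (s i) ≫ f.f ▷ 𝟙_ C) ⊗≫ 𝟙 _ := by
        rw [partialTrace]; monoidal
      _ = 𝟙 _ ⊗≫ A.1 ◁ lcoev (s i) ⊗≫ (f.f ▷ s i ≫ t ≫ f.f ▷ s i) ▷ dual (s i) ⊗≫
          B.1 ◁ rev (s i) ⊗≫ 𝟙 _ := by
        rw [← whisker_exchange f.f (lcoev (s i)), whisker_exchange f.f (rev (s i))]; monoidal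
      _ = 𝟙 _ ⊗≫ A.1 ◁ lcoev (s i) ⊗≫ (f.f ▷ (s i ⊗ dual (s i)) ≫ B.1 ◁ rev (s i)) ⊗≫ 𝟙 _ := by
        rw [hm]; monoidal
      _ = 𝟙 _ ⊗≫ A.1 ◁ rightDim (s i) ⊗≫ f.f ⊗≫ 𝟙 _ := by
        rw [← whisker_exchange f.f (rev (s i)), rightDim, rightTrace]; monoidal
      _ = 𝟙 _ ⊗≫ A.1 ◁ (h1.coeff (rightDim (s i)) • 𝟙 (𝟙_ C)) ⊗≫ f.f ⊗≫ 𝟙 _ := by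
        rw [h1.coeff_smul_id]
      _ = _ := by
        simp [monoidalComp]
  rw [Linear.smul_comp, Linear.comp_smul]
  ext
  rw [center_smul_f, key, smul_smul, inv_mul_cancel₀ hd, one_smul]

end IsSimpleSystem

end Average
end FusionCenter

namespace FusionCenter

/-! ### Semisimple linear categories with finite-dimensional morphism spaces -/

section Semisimple

variable {D : Type u} [Category.{v} D] [Preadditive D]

theorem IsAbelian.hasKernels (h : IsAbelian D) : HasKernels D := by
  obtain ⟨A, rfl⟩ := h
  infer_instance

theorem isSemisimple_of_biproducts [HasFiniteBiproducts D]
    (h : ∀ X : D, ∃ (n : ℕ) (S : Fin n → D), (∀ j, Simple (S j)) ∧ Nonempty (X ≅ ⨁ S)) :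
    IsSemisimple D := by
  intro X
  obtain ⟨n, S, hS, ⟨e⟩⟩ := h X
  let T : ULift.{v} (Fin n) → D := fun j => S j.down
  refine ⟨ULift.{v} (Fin n), T, Cofan.mk (⨁ T) (biproduct.ι T), fun j => hS _, ⟨?_⟩, ⟨?_⟩⟩
  · exact Cofan.IsColimit.mk _ (fun s => biproduct.desc s.inj) (fun s j => by simp [Cofan.inj])
      (fun s m hm => biproduct.hom_ext' _ _ fun j => by simpa using hm j)
  · exact e ≪≫ biproduct.whiskerEquiv (f := S) (g := T) Equiv.ulift.symm fun _ => Iso.refl _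

variable {k : Type w} [Field k] [Linear k D]

theorem IsScalar.isIso_of_retraction {X Y : D} (hX : IsScalar k X) (f : Y ⟶ X) (g : X ⟶ Y)
    (hfg : f ≫ g = 𝟙 Y) (hf : f ≠ 0) : IsIso f := by
  obtain ⟨c, hc⟩ := hX.exists_smul (g ≫ f)
  have h : c • f = (1 : k) • f := by
    rw [one_smul]
    nth_rw 2 [← Category.id_comp f]
    rw [← hfg, Category.assoc, hc, Linear.comp_smul, Category.comp_id]
  have hc1 : c = 1 := smul_left_injective k hf h
  exact ⟨g, hfg, by rw [hc, hc1, one_smul]⟩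

theorem IsScalar.simple {X : D} (hX : IsScalar k X)
    (h : ∀ {Y : D} (f : Y ⟶ X) [Mono f], f ≠ 0 → IsIso f) : Simple X where
  mono_isIso_iff_nonzero f hf := by
    refine ⟨fun hi h0 => hX.id_ne_zero ?_, h f⟩
    exact (cancel_epi f).1 (by simp [h0])

theorem FusionCategory.isSemisimple [MonoidalCategory D] [FusionCategory k D] :
    IsSemisimple D := by
  have := FusionCategory.hasFiniteBiproducts (k := k) (C := D)
  refine isSemisimple_of_biproducts fun X => ?_
  obtain ⟨n, S, hS, e⟩ := FusionCategory.exists_iso_biproduct (k := k) X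
  refine ⟨n, S, fun j => (hS j).simple fun f _ hf => ?_, e⟩
  obtain ⟨g, hg⟩ := (isSimpleSystem_scalarRep k D).exists_regular f
  exact (hS j).isIso_of_retraction f g (by rw [← cancel_mono f, Category.assoc, hg,
    Category.id_comp]) hf

/-- Simple subobjects of a semisimple object with finite-dimensional endomorphism algebra are
direct summands. -/
theorem IsSemisimple.exists_retraction [HasKernels D] (h : IsSemisimple D) {T X : D} [Simple T]
    [Module.Finite k (X ⟶ X)] (f : T ⟶ X) (hf : f ≠ 0) : ∃ r : X ⟶ T, f ≫ r = 𝟙 T := by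
  classical
  obtain ⟨J, S, c, hS, ⟨hc⟩, ⟨e⟩⟩ := h X
  let i : ∀ j, S j ⟶ X := fun j => c.inj j ≫ e.inv
  let p : ∀ j, X ⟶ S j := fun j => e.hom ≫ Cofan.IsColimit.desc hc
    (fun l => if h : l = j then eqToHom (by rw [h]) else 0)
  have hip : ∀ j, i j ≫ p j = 𝟙 _ := fun j => by simp [i, p]
  have hip' : ∀ l j, l ≠ j → i l ≫ p j = 0 := fun l j hlj => by simp [i, p, hlj]
  have hext : ∀ g g' : X ⟶ X, (∀ j, i j ≫ g = i j ≫ g') → g = g' := fun g g' hg => by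
    rw [← cancel_epi e.inv]
    exact Cofan.IsColimit.hom_ext hc _ _ fun j => by simpa [i] using hg j
  -- The projectors onto the summands are independent in the finite-dimensional `End X`, so there
  -- are finitely many summands and they sum to the identity. Some component of `f` is then nonzero,
  -- hence invertible by Schur.
  have hli : LinearIndependent k fun j => p j ≫ i j := by
    rw [linearIndependent_iff']
    intro s a h0 j hj
    have h1 : i j ≫ (∑ l ∈ s, a l • (p l ≫ i l)) ≫ p j = a j • 𝟙 (S j) := by
      rw [Preadditive.sum_comp, Preadditive.comp_sum, Finset.sum_eq_single_of_mem j hj]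
      · simp [hip]
      · intro l _ hl
        simp [hip' l j hl]
    rw [h0, zero_comp, comp_zero] at h1
    exact (smul_eq_zero.1 h1.symm).resolve_right (id_nonzero (S j))
  have hfin : Finite J := hli.finite
  have := Fintype.ofFinite J
  have hsum : ∑ j, p j ≫ i j = 𝟙 X := hext _ _ fun j => by
    rw [Preadditive.comp_sum, Finset.sum_eq_single j]
    · simp [reassoc_of% hip]
    · intro l _ hl
      simp [reassoc_of% hip' j l hl.symm]
    · simp
  obtain ⟨j, hj⟩ : ∃ j, f ≫ p j ≠ 0 := by
    by_contra! h0
    refine hf ?_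
    rw [← Category.comp_id f, ← hsum, Preadditive.comp_sum]
    exact Finset.sum_eq_zero fun j _ => by rw [← Category.assoc, h0, zero_comp]
  have := isIso_of_hom_simple hj
  exact ⟨p j ≫ inv (f ≫ p j), by rw [← Category.assoc, IsIso.hom_inv_id]⟩

/-- Induction on `dim End X`: by regularity a proper nonzero subobject splits off, with the kernel
of its retraction as complement, and both have smaller endomorphism algebras. -/
theorem exists_simple_decomposition [HasKernels D]
    (hfin : ∀ X Y : D, Module.Finite k (X ⟶ Y))
    (hreg : ∀ {X Y : D} (f : X ⟶ Y), ∃ g : Y ⟶ X, f ≫ g ≫ f = f) (X : D) :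
    ∃ (J : Type) (_ : Fintype J) (S : J → D) (i : ∀ j, S j ⟶ X) (p : ∀ j, X ⟶ S j),
      (∀ j, Simple (S j)) ∧ (∀ j, i j ≫ p j = 𝟙 _) ∧ (∀ l j, l ≠ j → i l ≫ p j = 0) ∧
      ∑ j, p j ≫ i j = 𝟙 X := by
  induction hn : Module.finrank k (X ⟶ X) using Nat.strong_induction_on generalizing X with
  | _ n ih =>
  subst hn
  by_cases h0 : 𝟙 X = 0
  · exact ⟨Empty, inferInstance, Empty.elim, fun j => j.elim, fun j => j.elim, fun j => j.elim,
      fun j => j.elim, fun j => j.elim, by simp [h0]⟩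
  by_cases hX : Simple X
  · exact ⟨Unit, inferInstance, fun _ => X, fun _ => 𝟙 X, fun _ => 𝟙 X, fun _ => hX,
      fun _ => Category.comp_id _, fun l j h => (h rfl).elim, by simp⟩
  obtain ⟨A, iA, hm, hiA, hiso⟩ : ∃ (A : D) (f : A ⟶ X), Mono f ∧ f ≠ 0 ∧ ¬ IsIso f := by
    by_contra! h
    refine hX ⟨fun {Y} f hf => ⟨fun hi hf0 => h0 ?_, h Y f hf⟩⟩
    exact (cancel_epi f).1 (by simp [hf0])
  obtain ⟨pA, hpA⟩ := hreg iA
  have hA : iA ≫ pA = 𝟙 A := by rw [← cancel_mono iA, Category.assoc, hpA, Category.id_comp]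
  let iB := kernel.ι pA
  have hBA : iB ≫ pA = 0 := kernel.condition pA
  let pB : X ⟶ kernel pA := kernel.lift pA (𝟙 X - pA ≫ iA) (by simp [hA])
  have hBi : pB ≫ iB = 𝟙 X - pA ≫ iA := kernel.lift_ι _ _ _
  have hsum : pA ≫ iA + pB ≫ iB = 𝟙 X := by rw [hBi]; abel
  have hB : iB ≫ pB = 𝟙 _ := by
    rw [← cancel_mono iB, Category.assoc, hBi]
    simp [reassoc_of% hBA]
  have hAB : iA ≫ pB = 0 := by
    rw [← cancel_mono iB, Category.assoc, hBi]
    simp [reassoc_of% hA]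
  -- `f ↦ p ≫ f ≫ i` embeds `End Y` in `End X`. It misses `𝟙 X`, since everything in its image is
  -- killed by precomposing with `j ≠ 0`.
  have hlt : ∀ {Y Z : D} (i : Y ⟶ X) (p : X ⟶ Y) (j : Z ⟶ X), i ≫ p = 𝟙 Y → j ≫ p = 0 →
      j ≠ 0 → Module.finrank k (Y ⟶ Y) < Module.finrank k (X ⟶ X) := by
    intro Y Z i p j hip hjp hj
    let φ : (Y ⟶ Y) →ₗ[k] (X ⟶ X) := Linear.leftComp k X p ∘ₗ Linear.rightComp k Y i
    have hφ : ∀ f, φ f = p ≫ f ≫ i := fun f => rfl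
    have := hfin X X
    have hinj : Function.Injective φ := by
      intro f g hfg
      rw [hφ, hφ] at hfg
      have := congrArg (fun t => i ≫ t ≫ p) hfg
      simpa [hip, reassoc_of% hip] using this
    rw [← LinearMap.finrank_range_of_inj hinj]
    refine Submodule.finrank_lt fun htop => hj ?_
    obtain ⟨f, hf⟩ := LinearMap.range_eq_top.1 htop (𝟙 X)
    rw [← Category.comp_id j, ← hf, hφ, reassoc_of% hjp, zero_comp]
  have hB0 : iB ≠ 0 := fun h => hiso ⟨pA, hA, by rw [← hsum, h, comp_zero, add_zero]⟩
  obtain ⟨J, _, S, i, p, hS, h1, h2, h3⟩ := ih _ (hlt iA pA iB hA hBA hB0) A rfl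
  obtain ⟨J', _, S', i', p', hS', h1', h2', h3'⟩ := ih _ (hlt iB pB iA hB hAB hiA) _ rfl
  refine ⟨J ⊕ J', inferInstance, Sum.elim S S',
    fun j => match j with
      | .inl j => i j ≫ iA
      | .inr j => i' j ≫ iB,
    fun j => match j with
      | .inl j => pA ≫ p j
      | .inr j => pB ≫ p' j, ?_, ?_, ?_, ?_⟩
  · rintro (j | j)
    exacts [hS j, hS' j]
  · rintro (j | j)
    · simpa [reassoc_of% hA] using h1 j
    · simpa [reassoc_of% hB] using h1' j
  · rintro (l | l) (j | j) hlj
    · have h : (i l ≫ iA) ≫ pA ≫ p j = 0 := by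
        simpa [reassoc_of% hA] using h2 l j (by simpa using hlj)
      exact h
    · have h : (i l ≫ iA) ≫ pB ≫ p' j = 0 := by simp [reassoc_of% hAB]
      exact h
    · have h : (i' l ≫ iB) ≫ pA ≫ p j = 0 := by simp [reassoc_of% hBA]
      exact h
    · have h : (i' l ≫ iB) ≫ pB ≫ p' j = 0 := by
        simpa [reassoc_of% hB] using h2' l j (by simpa using hlj)
      exact h
  · rw [Fintype.sum_sum_type, ← hsum]
    congr 1
    · conv_rhs => rw [← Category.id_comp iA, ← h3]
      simp only [Preadditive.sum_comp, Preadditive.comp_sum, Category.assoc]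
      exact Finset.sum_congr rfl fun j _ => Category.assoc _ _ _
    · conv_rhs => rw [← Category.id_comp iB, ← h3']
      simp only [Preadditive.sum_comp, Preadditive.comp_sum, Category.assoc]
      exact Finset.sum_congr rfl fun j _ => Category.assoc _ _ _

theorem exists_iso_biproduct_simple [HasFiniteBiproducts D] [HasKernels D]
    (hfin : ∀ X Y : D, Module.Finite k (X ⟶ Y))
    (hreg : ∀ {X Y : D} (f : X ⟶ Y), ∃ g : Y ⟶ X, f ≫ g ≫ f = f) (X : D) :
    ∃ (n : ℕ) (S : Fin n → D), (∀ j, Simple (S j)) ∧ Nonempty (X ≅ ⨁ S) := by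
  classical
  obtain ⟨J, _, S, i, p, hS, h1, h2, h3⟩ := exists_simple_decomposition hfin hreg X
  have e := (Fintype.equivFin J).symm
  refine ⟨Fintype.card J, fun a => S (e a), fun a => hS _,
    ⟨⟨biproduct.lift fun a => p (e a), biproduct.desc fun a => i (e a), ?_, ?_⟩⟩⟩
  · rw [biproduct.lift_desc, ← h3]
    exact Equiv.sum_comp e fun j => p j ≫ i j
  · ext a b
    by_cases hab : b = a
    · subst hab
      simp [h1]
    · simp [biproduct.ι_π_ne _ hab, h2 _ _ (e.injective.ne hab)]

theorem Simple.isScalar [IsAlgClosed k] [HasKernels D] (X : D) [Simple X]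
    [Module.Finite k (X ⟶ X)] : IsScalar k X := by
  have h := (finrank_eq_one_iff_of_nonzero' (𝟙 X) (id_nonzero X)).1
    (finrank_endomorphism_simple_eq_one k X)
  exact ⟨smul_left_injective k (id_nonzero X), h⟩

end Semisimple
end FusionCenter

namespace FusionCenter

/-! ### Semisimplicity and fusion structure of the center -/

section CenterFusion

variable {C : Type u} [Category.{v} C] [MonoidalCategory C] [Preadditive C] [MonoidalPreadditive C]

instance : MonoidalPreadditive (Center C) where
  whiskerLeft_zero {X _ _} := Center.ext _ _ (MonoidalPreadditive.whiskerLeft_zero (X := X.1))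
  zero_whiskerRight {X _ _} := Center.ext _ _ (MonoidalPreadditive.zero_whiskerRight (X := X.1))
  whiskerLeft_add f g := Center.ext _ _ (MonoidalPreadditive.whiskerLeft_add f.f g.f)
  add_whiskerRight f g := Center.ext _ _ (MonoidalPreadditive.add_whiskerRight f.f g.f)

variable {k : Type w} [Field k] [Linear k C] [MonoidalLinear k C]

instance : MonoidalLinear k (Center C) where
  whiskerLeft_smul X _ _ r f := Center.ext _ _ (MonoidalLinear.whiskerLeft_smul X.1 r f.f)
  smul_whiskerRight r _ _ f X := Center.ext _ _ (MonoidalLinear.smul_whiskerRight r f.f X.1)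

theorem center_finite_hom (A B : Center C) [Module.Finite k (A.1 ⟶ B.1)] :
    Module.Finite k (A ⟶ B) :=
  let φ : (A ⟶ B) →ₗ[k] (A.1 ⟶ B.1) :=
    { toFun := fun f => f.f, map_add' := fun _ _ => rfl, map_smul' := fun _ _ => rfl }
  Module.Finite.of_injective φ fun _ _ h => Center.ext _ _ h

theorem center_isScalar {A : Center C} (hA : IsScalar k A.1) : IsScalar k A := by
  refine ⟨fun a b h => hA.1 (congrArg Center.Hom.f h), fun f => ?_⟩
  obtain ⟨c, hc⟩ := hA.2 f.f
  exact ⟨c, Center.ext _ _ hc⟩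

/-- A nonzero subobject in the center splits in `C`, hence is everything there, and the forgetful
functor reflects isomorphisms. This needs nothing about the dimension and applies to the unit. -/
theorem IsSimpleSystem.center_simple [HasFiniteBiproducts C] {I : Type*} [Fintype I] {s : I → C}
    (hs : IsSimpleSystem k s) {A : Center C} (hA : IsScalar k A.1) : Simple A := by
  refine (center_isScalar hA).simple fun {Y} f _ hf => ?_
  obtain ⟨g, hg⟩ := exists_retraction_of_mono hs.exists_regular hs.exists_split_idempotent f
  have hf' : f.f ≠ 0 := fun h => hf (Center.ext _ _ h)
  have : IsIso ((Center.forget C).map f) := hA.isIso_of_retraction f.f g hg hf'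
  exact isIso_of_reflects_iso f (Center.forget C)

/-- The component at `V = 𝟙` of the family recovers `g` up to isomorphism. -/
theorem IsCofree.center_lift_ne_zero {X R : C} {u : ∀ V, R ⊗ V ⟶ V ⊗ X} (hu : IsCofree u)
    {L : C → C} {P : ∀ X, ExactPairing (L X) X} {A : Center C} {g : A.1 ⟶ X} (hg : g ≠ 0)
    {a : A ⟶ hu.center L P} (ha : ∀ V, a.f ▷ V ≫ u V = (A.2.β V).hom ≫ V ◁ g) : a ≠ 0 := by
  rintro rfl
  have h := ha (𝟙_ C)
  have h0 : (0 : A.1 ⟶ R) ▷ 𝟙_ C ≫ u (𝟙_ C) = 0 := by simp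
  have h1 : 𝟙_ C ◁ g = 0 := by
    rw [← cancel_epi (A.2.β (𝟙_ C)).hom, ← h, comp_zero]
    exact h0
  refine hg ?_
  rw [← cancel_epi (λ_ A.1).hom, ← leftUnitor_naturality, h1, zero_comp, comp_zero]

section

open PivotalCategory

variable [PivotalCategory C] [HasFiniteBiproducts C] {I : Type*} [Fintype I] {s : I → C}
  (hs : IsSimpleSystem k s)
include hs

theorem IsSimpleSystem.sum_dim_ne_zero_of_isSemisimple (h1 : IsScalar k (𝟙_ C))
    (h : IsSemisimple (Center C)) :
    ∑ i, h1.coeff (rightDim (s i)) * h1.coeff (leftDim (s i)) ≠ 0 := by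
  obtain ⟨R, u, hu⟩ := exists_isCofree hs (fun i => dual (s i)) (fun i => leftPairing (s i)) (𝟙_ C)
  obtain ⟨η, hη⟩ := hu.exists_center_lift dual rightPairing (𝟙_ (Center C)) (𝟙 (𝟙_ C))
  have hη0 : η ≠ 0 := hu.center_lift_ne_zero h1.id_ne_zero hη
  have := (center_isAbelian (C := C) hs.exists_regular hs.exists_split_idempotent).hasKernels
  have : Simple (𝟙_ (Center C)) := hs.center_simple (A := 𝟙_ (Center C)) h1
  have : Module.Finite k (hu.center dual rightPairing ⟶ hu.center dual rightPairing) :=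
    have := hs.finite_hom (hu.center dual rightPairing).1 (hu.center dual rightPairing).1
    center_finite_hom _ _
  obtain ⟨r, hr⟩ := h.exists_retraction (k := k) η hη0
  refine hs.sum_dim_ne_zero h1 hu (η := η.f) (r := r.f) (fun V => ?_) (fun V => ?_)
    (congrArg Center.Hom.f hr)
  · have h2 : ((λ_ V).hom ≫ (ρ_ V).inv) ≫ V ◁ 𝟙 (𝟙_ C) = (λ_ V).hom ≫ (ρ_ V).inv := by simp
    exact (hη V).trans h2
  · exact r.comm V

theorem IsSimpleSystem.center_isSemisimple (h1 : IsScalar k (𝟙_ C))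
    (hd : ∑ i, h1.coeff (rightDim (s i)) * h1.coeff (leftDim (s i)) ≠ 0) :
    IsSemisimple (Center C) := by
  have := (center_isAbelian (C := C) hs.exists_regular hs.exists_split_idempotent).hasKernels
  have := center_hasFiniteBiproducts (C := C)
  exact isSemisimple_of_biproducts (exists_iso_biproduct_simple (k := k)
    (fun A B => have := hs.finite_hom A.1 B.1; center_finite_hom A B)
    (hs.exists_center_regular h1 hd))

theorem IsSimpleSystem.center_fusionCategory [IsAlgClosed k] (h1 : IsScalar k (𝟙_ C))
    (hd : ∑ i, h1.coeff (rightDim (s i)) * h1.coeff (leftDim (s i)) ≠ 0) :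
    FusionCategory k (Center C) := by
  have := (center_isAbelian (C := C) hs.exists_regular hs.exists_split_idempotent).hasKernels
  have := center_hasFiniteBiproducts (C := C)
  have hfin : ∀ A B : Center C, Module.Finite k (A ⟶ B) := fun A B =>
    have := hs.finite_hom A.1 B.1
    center_finite_hom A B
  have hdec := exists_iso_biproduct_simple (k := k) hfin (hs.exists_center_regular h1 hd)
  have hsimple : ∀ {Z : Center C}, IsScalar k Z → Simple Z := fun {Z} hZ =>
    hZ.simple fun f _ hf => by
      obtain ⟨g, hg⟩ := hs.exists_center_regular h1 hd f
      exact hZ.isIso_of_retraction f g (by rw [← cancel_mono f, Category.assoc, hg,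
        Category.id_comp]) hf
  refine
    { rigid := ⟨centerRigid dual dual rightPairing leftPairing⟩
      exists_iso_biproduct := fun Z => ?_
      hom_eq_zero := fun Y Z hY hZ hYZ f => ?_
      finite_scalarClasses := ?_
      unit_scalar := center_isScalar (A := 𝟙_ (Center C)) h1 }
  · obtain ⟨n, S, hS, e⟩ := hdec Z
    exact ⟨n, S, fun j => have := hS j; Simple.isScalar (S j), e⟩
  · have := hsimple hY
    have := hsimple hZ
    by_contra hf
    have := isIso_of_hom_simple hf
    exact hYZ ⟨asIso f⟩
  -- A simple `Z` has a nonzero map in `C` to some `s i`, hence one in the center to the cofree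
  -- object on `s i`. So `Z` is isomorphic to one of the finitely many simple summands of these
  -- cofree objects.
  · choose R u hu using fun i => exists_isCofree hs (fun j => dual (s j))
      (fun j => leftPairing (s j)) (s i)
    choose n S hS e using fun i => hdec ((hu i).center dual rightPairing)
    refine (Set.finite_range fun x : Σ i, Fin (n i) =>
      Quotient.mk (isIsomorphicSetoid (Center C)) (S x.1 x.2)).subset ?_
    rintro _ ⟨Z, hZ, rfl⟩
    have := hsimple hZ
    obtain ⟨i, g, hg⟩ : ∃ i, ∃ g : Z.1 ⟶ s i, g ≠ 0 := by
      by_contra! h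
      refine hZ.id_ne_zero (Center.ext _ _ (hs.hom_ext' fun i y => ?_))
      rw [h i (_ ≫ y), h i (_ ≫ y)]
    obtain ⟨a, ha⟩ := (hu i).exists_center_lift dual rightPairing Z g
    have ha0 : a ≠ 0 := (hu i).center_lift_ne_zero hg ha
    obtain ⟨e⟩ := e i
    obtain ⟨j, hj⟩ : ∃ j, (a ≫ e.hom) ≫ biproduct.π (S i) j ≠ 0 := by
      by_contra! h
      refine ha0 ((cancel_mono e.hom).1 (biproduct.hom_ext _ _ fun j => ?_))
      rw [h j, zero_comp, zero_comp]
    have := hS i j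
    have := isIso_of_hom_simple hj
    exact ⟨⟨i, j⟩, Quotient.sound ⟨(asIso ((a ≫ e.hom) ≫ biproduct.π (S i) j)).symm⟩⟩

end

omit [MonoidalPreadditive C] [MonoidalLinear k C] in
theorem fusionDim_eq_sum [PivotalCategory C] [FusionCategory k C] :
    fusionDim k C = ∑ i : ScalarClass k C,
      (FusionCategory.unit_scalar (k := k) (C := C)).coeff (rightDim (scalarRep k i)) *
        (FusionCategory.unit_scalar (k := k) (C := C)).coeff (leftDim (scalarRep k i)) :=
  (Finset.sum_coe_sort _ fun q : Quotient (isIsomorphicSetoid C) =>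
    (FusionCategory.unit_scalar (k := k) (C := C)).coeff (rightDim q.out) *
      (FusionCategory.unit_scalar (k := k) (C := C)).coeff (leftDim q.out)).symm

end CenterFusion
end FusionCenter

theorem mainTheorem4 {k : Type w} [Field k] {C : Type u} [Category.{v} C] [MonoidalCategory C]
    [Preadditive C] [Linear k C] [MonoidalPreadditive C] [MonoidalLinear k C]
    [FusionCenter.FusionCategory k C] [FusionCenter.PivotalCategory C] :
    FusionCenter.IsAbelian (Center C) ∧
    (FusionCenter.IsSemisimple (Center C) ↔ FusionCenter.fusionDim k C ≠ 0) ∧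
    (IsAlgClosed k →
      (FusionCenter.FusionCategory k (Center C) ↔ FusionCenter.fusionDim k C ≠ 0)) := by
  have := FusionCenter.FusionCategory.hasFiniteBiproducts (k := k) (C := C)
  have hs := FusionCenter.isSimpleSystem_scalarRep k C
  have h1 := FusionCenter.FusionCategory.unit_scalar (k := k) (C := C)
  rw [FusionCenter.fusionDim_eq_sum]
  refine ⟨FusionCenter.center_isAbelian hs.exists_regular hs.exists_split_idempotent,
    ⟨hs.sum_dim_ne_zero_of_isSemisimple h1, hs.center_isSemisimple h1⟩, fun _ =>
    ⟨fun _ => hs.sum_dim_ne_zero_of_isSemisimple h1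
      (FusionCenter.FusionCategory.isSemisimple (k := k)), hs.center_fusionCategory h1⟩⟩
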